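/- Let $n\ge 0$ be an integer, $m=\lfloor n/2\rfloor$ and $\mu=n-2m\in\{0,1\}$, and let $(w_1,w_2)$ be one of the following pairs of even weights (with $a>-1$ a real parameter): - Gauss: $w_1(x)=e^{-x^2/2}$, $w_2(x)=e^{-x^2}$ on $\mathbb R$; - symmetric Jacobi: $w_1(x)=(1-x^2)^a$, $w_2(x)=(1-x^2)^{2a+1}$ on $(-1,1)$, both zero outside $(-1,1)$; - Cauchy: $w_1(x)=(1+x^2)^{-(n+a+1)/2}$, $w_2(x)=(1+x^2)^{-(n+a)}$ on $\mathbb R$. Write $\Delta(\xi_1,\dots,\xi_N)=\prod_{j<k}(\xi_k-\xi_j)$. Let $\mathrm{OE}_n(w_1)$ be the orthogonal ensemble, whose eigenvalues $x_1,\dots,x_n\in\mathbb R$ have joint density proportional to $\prod_{k=1}^n w_1(x_k)\,|\Delta(x_1,\dots,x_n)|$, and let $\mathrm{chUE}_m(w)$ be the chiral unitary ensemble, whose positive eigenvalues $x_1,\dots,x_m\in(0,\infty)$ have joint density proportional to $\prod_{k=1}^m w(x_k)\,\Delta(x_1^2,\dots,x_m^2)^2$. Let $\mathrm{even}\,|\mathrm{OE}_n(w_1)|$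 be the ensemble formed by the 2nd largest, 4th largest, $\dots$, $2m$-th largest of the singular values $|x_1|,\dots,|x_n|$ of $\mathrm{OE}_n(w_1)$. Then the densities of $\mathrm{OE}_n(w_1)$ and of $\mathrm{chUE}_m(x^{2\mu}w_2)$ can be normalized to probability densities, and $$\mathrm{even}\,|\mathrm{OE}_n(w_1)|\overset{\mathrm d}{=}\mathrm{chUE}_m(x^{2\mu}w_2),$$ that is, the joint distribution of the even-location singular values, listed in decreasing order, equals that of the eigenvalues of $\mathrm{chUE}_m(x^{2\mu}w_2)$, listed in decreasing order. -/

import Mathlib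

open MeasureTheory

noncomputable section

/-- The pairs `(w₁, w₂)` of even weights of order `n` supported on `(-ω, ω)`: Gauss (`ω = ∞`),
symmetric Jacobi (`ω = 1`) and Cauchy (`ω = ∞`; here the weights depend on the order `n`). -/
inductive IsEvenWeightPair (n : ℕ) : (ℝ → ℝ) → (ℝ → ℝ) → Prop
  | gauss : IsEvenWeightPair n
      (fun x => Real.exp (-x ^ 2 / 2))
      (fun x => Real.exp (-x ^ 2))
  | jacobi (a : ℝ) (ha : -1 < a) : IsEvenWeightPair n
      ((Set.Ioo (-1 : ℝ) 1).indicator fun x => (1 - x ^ 2) ^ a)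
      ((Set.Ioo (-1 : ℝ) 1).indicator fun x => (1 - x ^ 2) ^ (2 * a + 1))
  | cauchy (a : ℝ) (ha : -1 < a) : IsEvenWeightPair n
      (fun x => (1 + x ^ 2) ^ (-((n : ℝ) + a + 1) / 2))
      (fun x => (1 + x ^ 2) ^ (-((n : ℝ) + a)))

/-- The Vandermonde determinant `Δ(ξ₁, …, ξₙ) = ∏_{k > j} (ξ_k - ξ_j)`. -/
def vandermondeDet {n : ℕ} (ξ : Fin n → ℝ) : ℝ := (Matrix.vandermonde ξ).det

/-- The measure on `ℝⁿ` with Lebesgue density proportional to `f ≥ 0`, normalized to have total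
mass one (this is a probability measure when `0 < ∫ f < ∞`). -/
def normalizedMeasure {n : ℕ} (f : (Fin n → ℝ) → ℝ) : Measure (Fin n → ℝ) :=
  (∫⁻ x, ENNReal.ofReal (f x))⁻¹ • (volume.withDensity fun x => ENNReal.ofReal (f x))

/-- The orthogonal ensemble `OE_n(w)`: the law of its (unordered) eigenvalues, with density
proportional to `∏ w(x_k) · |Δ(x₁, …, xₙ)|`. -/
def orthogonalEnsemble (n : ℕ) (w : ℝ → ℝ) : Measure (Fin n → ℝ) :=
  normalizedMeasure fun x => (∏ k, w (x k)) * |vandermondeDet x|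

/-- The chiral unitary ensemble `chUE_n(w)`: the law of its (unordered) positive eigenvalues, with
density proportional to `∏ w(x_k) · Δ(x₁², …, xₙ²)²` on `(0, ∞)ⁿ`. -/
def chiralUnitaryEnsemble (n : ℕ) (w : ℝ → ℝ) : Measure (Fin n → ℝ) :=
  normalizedMeasure fun x =>
    (∏ k, (Set.Ioi (0 : ℝ)).indicator w (x k)) * vandermondeDet (fun k => x k ^ 2) ^ 2

/-- The components of `x` listed in decreasing order (with multiplicity). -/
def sortDecreasing {n : ℕ} (x : Fin n → ℝ) : Fin n → ℝ := fun i => x (Tuple.sort x i.rev)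

/-- The singular values, i.e. the absolute values of the eigenvalues, in decreasing order. -/
def singularValues {n : ℕ} (x : Fin n → ℝ) : Fin n → ℝ := sortDecreasing fun k => |x k|

/-- Even-location decimation: keep the 2nd, 4th, … entry of a list (indices start at `0`, so these
are the entries with index `1, 3, …`). -/
def evenLocations {n : ℕ} (σ : Fin n → ℝ) : Fin (n / 2) → ℝ :=
  fun j => σ ⟨2 * (j : ℕ) + 1, by omega⟩

/-- The ensemble `even |OE_n(w)|`: the joint law, in decreasing order, of the 2nd largest, 4th
largest, … singular value of `OE_n(w)`. -/
def evenDecimatedSingularValues (n : ℕ) (w : ℝ → ℝ) : Measure (Fin (n / 2) → ℝ) :=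
  (orthogonalEnsemble n w).map fun x => evenLocations (singularValues x)

theorem sortDecreasing_antitone {n : ℕ} (x : Fin n → ℝ) : Antitone (sortDecreasing x) :=
  fun _ _ h => Tuple.monotone_sort x (Fin.rev_le_rev.mpr h)

theorem measurable_sortDecreasing (n : ℕ) :
    Measurable (sortDecreasing : (Fin n → ℝ) → Fin n → ℝ) := by
  have h : ∀ σ : Equiv.Perm (Fin n), MeasurableSet {x : Fin n → ℝ | Tuple.sort x = σ} := by
    intro σ
    have e : {x : Fin n → ℝ | Tuple.sort x = σ} =
        {x | (∀ i j, i ≤ j → x (σ i) ≤ x (σ j)) ∧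
          ∀ i j, i < j → x (σ i) = x (σ j) → σ i < σ j} := by
      ext x
      rw [Set.mem_ofPred_eq, eq_comm, Tuple.eq_sort_iff]
      rfl
    rw [e]
    measurability
  refine measurable_pi_iff.mpr fun i s hs => ?_
  have e : (fun x : Fin n → ℝ => sortDecreasing x i) ⁻¹' s =
      ⋃ σ : Equiv.Perm (Fin n), {x | Tuple.sort x = σ} ∩ {x | x (σ i.rev) ∈ s} := by
    ext x
    simp [sortDecreasing]
  rw [e]
  exact MeasurableSet.iUnion fun σ => (h σ).inter (measurable_pi_apply (σ i.rev) hs)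

end

/-!
The joint density of `OE_n(w₁)` is symmetric under permutations, and the even-location singular
values are invariant under permutations and sign changes of the eigenvalues, so every integral can
be folded onto the chamber `x₁ > ⋯ > xₙ > 0` (`lintegral_symmetric_signs`), at the price of summing
`|Δ(ε₁x₁, …, εₙxₙ)|` over all choices of signs. On the chamber each factor of `Δ(εx)` has a sign
that depends on a single `ε_i`, so the absolute value only multiplies the rows of the Vandermonde
matrix by signs; summing over `ε` row by row then kills every entry whose exponent has the wrong
parity. What remains is a checkerboard matrix, and its determinant is a product of two Vandermonde
determinants in the squares, one for the even locations `t` and one for the odd locations `o`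
(`sum_abs_vandermondeDet_sign`). Writing `μ = n mod 2`, the density on the chamber is
`2ⁿ ∏ w₁(t) t^μ |Δ(t²)| · ∏ w₁(o) o^(1-μ) |Δ(o²)|`.

Given `t`, the odd locations range over a product of intervals that interlace with `t`, and the
integral over `o` is the determinant of the moments of `w₁` over these intervals. Adding consecutive
rows replaces the intervals by half-lines `(t_i, ∞)`. Each of the three weights `w₁` has a companion
`W` with `w₂ = w₁ W`, such that `(W(u) u^j)'` is `w₁(u)` times a combination of `u^(j+1)` and
`u^(j-1)` whose leading coefficient does not vanish for `j ≤ n - 2`. Hence column operations turn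
the half-line moments into constants times `W(t_i) t_i^(2k+μ)`. For odd `n` the zeroth moments stay
as a further column, but the last half-line is `(0, ∞)`, where all other columns vanish. In both
cases the determinant is a constant multiple of `∏ W(t) t^μ |Δ(t²)|`
(`IsEvenWeightWithCompanion.lintegral_interlacing`), and the product with the remaining factor is
the density of `chUE_m(x^(2μ) w₂)` up to a constant.

So the two unnormalized laws are proportional. The normalization of one follows from that of the
other, and the mass of `OE_n(w₁)` is finite because its density is the absolute value of a
determinant of integrable functions of the single variables.
-/

/-! ### Determinants summed over signs -/

/-- The sign of a unit of `ℤ`, as a real number. -/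
abbrev signVal (ε : ℤˣ) : ℝ := ((ε : ℤ) : ℝ)

theorem abs_signVal (ε : ℤˣ) : |signVal ε| = 1 := by
  rcases Int.units_eq_one_or ε with rfl | rfl <;> simp [signVal]

/-- If the entries of `x` are positive and decreasing, the factors `ε_j x_j - ε_i x_i`, `i < j`, of
the Vandermonde determinant have the sign of `-ε_i`. -/
theorem abs_vandermondeDet_sign_mul {n : ℕ} (x : Fin n → ℝ) (hx : StrictAnti x)
    (h0 : ∀ i, 0 < x i) (ε : Fin n → ℤˣ) :
    |vandermondeDet fun i => signVal (ε i) * x i| =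
      (∏ i, (-signVal (ε i)) ^ (Finset.Ioi i).card) *
        vandermondeDet fun i => signVal (ε i) * x i := by
  rw [vandermondeDet, Matrix.det_vandermonde, Finset.abs_prod, ← Finset.prod_mul_distrib]
  refine Finset.prod_congr rfl fun i _ => ?_
  rw [Finset.abs_prod, ← Finset.prod_const, ← Finset.prod_mul_distrib]
  refine Finset.prod_congr rfl fun j hj => ?_
  have hij : x j < x i := hx (Finset.mem_Ioi.mp hj)
  have hi := h0 i
  have hj := h0 j
  rcases Int.units_eq_one_or (ε i) with h | h <;> rcases Int.units_eq_one_or (ε j) with h' | h' <;>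
    simp only [signVal, h, h', Units.val_one, Units.val_neg, Int.cast_one, Int.cast_neg]
  · rw [abs_of_neg (by linarith)]; ring
  · rw [abs_of_neg (by linarith)]; ring
  · rw [abs_of_pos (by linarith)]; ring
  · rw [abs_of_pos (by linarith)]; ring

theorem abs_vandermondeDet_of_strictAnti {n : ℕ} (x : Fin n → ℝ) (hx : StrictAnti x) :
    |vandermondeDet x| = (∏ i : Fin n, (-1 : ℝ) ^ (Finset.Ioi i).card) * vandermondeDet x := by
  rw [vandermondeDet, Matrix.det_vandermonde, Finset.abs_prod, ← Finset.prod_mul_distrib]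
  refine Finset.prod_congr rfl fun i _ => ?_
  rw [Finset.abs_prod, ← Finset.prod_const, ← Finset.prod_mul_distrib]
  refine Finset.prod_congr rfl fun j hj => ?_
  have hij : x j < x i := hx (Finset.mem_Ioi.mp hj)
  rw [abs_of_neg (by linarith)]; ring

/-- Multilinearity of the determinant in its rows: a sum over independent choices in all rows may
be performed row by row. -/
theorem sum_det_eq_det_sum {n : ℕ} {κ : Type*} [Fintype κ] (A : κ → Fin n → Fin n → ℝ) :
    ∑ ε : Fin n → κ, (Matrix.of fun i k => A (ε i) i k).det =
      (Matrix.of fun i k => ∑ e, A e i k).det := by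
  classical
  simp only [Matrix.det_apply', Matrix.of_apply]
  rw [Finset.sum_comm]
  refine Finset.sum_congr rfl fun σ _ => ?_
  rw [← Finset.mul_sum]
  congr 1
  have h1 := fun ε : Fin n → κ => Equiv.prod_comp σ.symm fun i => A (ε (σ i)) (σ i) i
  have h2 := Equiv.prod_comp σ.symm fun i => ∑ e, A e (σ i) i
  simp only [Equiv.apply_symm_apply] at h1 h2
  simp only [← h1]
  rw [← h2, Finset.prod_univ_sum, Fintype.piFinset_univ]

/-- The splitting of the index set into the even locations `2j + 1` and the odd locations `2i`
(indices start at `0`). -/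
noncomputable def locationEquiv (n : ℕ) : Fin (n / 2) ⊕ Fin ((n + 1) / 2) ≃ Fin n :=
  Equiv.ofBijective
    (Sum.elim (fun j => ⟨2 * (j : ℕ) + 1, by omega⟩) fun i => ⟨2 * (i : ℕ), by omega⟩) <| by
    rw [Fintype.bijective_iff_injective_and_card]
    refine ⟨?_, by simp; omega⟩
    rintro (a | a) (b | b) h <;> simp [Fin.ext_iff] at h <;> first | omega | (congr 1; ext; omega)

/-- The splitting of the exponents `k < n` into those with the parity of `n` and those with the
opposite parity. -/
noncomputable def exponentEquiv (n : ℕ) : Fin (n / 2) ⊕ Fin ((n + 1) / 2) ≃ Fin n :=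
  Equiv.ofBijective
    (Sum.elim (fun j => ⟨2 * (j : ℕ) + n % 2, by omega⟩)
      fun i => ⟨2 * (i : ℕ) + (1 - n % 2), by omega⟩) <| by
    rw [Fintype.bijective_iff_injective_and_card]
    refine ⟨?_, by simp; omega⟩
    rintro (a | a) (b | b) h <;> simp [Fin.ext_iff] at h <;> first | omega | (congr 1; ext; omega)

@[simp] theorem locationEquiv_inl {n : ℕ} (j : Fin (n / 2)) :
    (locationEquiv n (Sum.inl j) : ℕ) = 2 * (j : ℕ) + 1 := rfl

@[simp] theorem locationEquiv_inr {n : ℕ} (i : Fin ((n + 1) / 2)) :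
    (locationEquiv n (Sum.inr i) : ℕ) = 2 * (i : ℕ) := rfl

@[simp] theorem exponentEquiv_inl {n : ℕ} (j : Fin (n / 2)) :
    (exponentEquiv n (Sum.inl j) : ℕ) = 2 * (j : ℕ) + n % 2 := rfl

@[simp] theorem exponentEquiv_inr {n : ℕ} (i : Fin ((n + 1) / 2)) :
    (exponentEquiv n (Sum.inr i) : ℕ) = 2 * (i : ℕ) + (1 - n % 2) := rfl

theorem abs_det_mul_pow {m : ℕ} (r y : Fin m → ℝ) (d : ℕ) :
    |(Matrix.of fun i k : Fin m => r i * y i ^ (2 * (k : ℕ) + d)).det| =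
      (∏ i, |r i * y i ^ d|) * |vandermondeDet fun i => y i ^ 2| := by
  have : (Matrix.of fun i k : Fin m => r i * y i ^ (2 * (k : ℕ) + d)) =
      Matrix.of fun i k => (r i * y i ^ d) * Matrix.vandermonde (fun i => y i ^ 2) i k := by
    ext i k
    simp only [Matrix.of_apply, Matrix.vandermonde_apply]
    ring
  rw [this, Matrix.det_mul_column, abs_mul, Finset.abs_prod, vandermondeDet]

/-- For positive decreasing singular values the sum of the Vandermonde determinants over all
choices of signs factors into the even and the odd locations. -/
theorem sum_abs_vandermondeDet_sign {n : ℕ} (x : Fin n → ℝ) (hx : StrictAnti x)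
    (h0 : ∀ i, 0 < x i) :
    ∑ ε : Fin n → ℤˣ, |vandermondeDet fun i => signVal (ε i) * x i| =
      2 ^ n *
      (((∏ j, x (locationEquiv n (Sum.inl j)) ^ (n % 2)) *
          |vandermondeDet fun j => x (locationEquiv n (Sum.inl j)) ^ 2|) *
        ((∏ i, x (locationEquiv n (Sum.inr i)) ^ (1 - n % 2)) *
          |vandermondeDet fun i => x (locationEquiv n (Sum.inr i)) ^ 2|)) := by
  set M : Matrix (Fin n) (Fin n) ℝ := Matrix.of fun i k =>
    ∑ e : ℤˣ, (-signVal e) ^ (n - 1 - (i : ℕ)) * (signVal e * x i) ^ (k : ℕ) with hM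
  have h1 : ∑ ε : Fin n → ℤˣ, |vandermondeDet fun i => signVal (ε i) * x i| = M.det := by
    rw [hM, ← sum_det_eq_det_sum]
    refine Finset.sum_congr rfl fun ε _ => ?_
    rw [abs_vandermondeDet_sign_mul x hx h0, vandermondeDet, ← Matrix.det_mul_column]
    congr 1
    ext i k
    simp [Matrix.vandermonde_apply, Fin.card_Ioi]
  have hMs : ∀ i k, M i k = ((-1) ^ (n - 1 - (i : ℕ)) + (-1) ^ (k : ℕ)) * x i ^ (k : ℕ) := by
    intro i k
    rw [hM]
    simp only [Matrix.of_apply, UnitsInt.univ]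
    rw [Finset.sum_pair (by decide)]
    simp only [signVal, Units.val_one, Units.val_neg, Int.cast_one, Int.cast_neg, one_mul,
      neg_mul, neg_neg, one_pow]
    rw [neg_pow (x i)]
    ring
  -- `M` is a checkerboard matrix: the two signs cancel unless `n - 1 - i + k` is even.
  have hM2 : ∀ i k : Fin n, (n - 1 - (i : ℕ) + k) % 2 = 0 →
      M i k = (-1) ^ (n - 1 - (i : ℕ)) * 2 * x i ^ (k : ℕ) := by
    intro i k h
    have : (-1 : ℝ) ^ (k : ℕ) = (-1) ^ (n - 1 - (i : ℕ)) := by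
      rw [neg_one_pow_eq_pow_mod_two, neg_one_pow_eq_pow_mod_two (n := n - 1 - (i : ℕ))]
      congr 1; omega
    rw [hMs, this]; ring
  have hM0 : ∀ i k : Fin n, (n - 1 - (i : ℕ) + k) % 2 = 1 → M i k = 0 := by
    intro i k h
    have : (-1 : ℝ) ^ (k : ℕ) = -(-1) ^ (n - 1 - (i : ℕ)) := by
      rw [neg_one_pow_eq_pow_mod_two, neg_one_pow_eq_pow_mod_two (n := n - 1 - (i : ℕ))]
      rcases Nat.mod_two_eq_zero_or_one (k : ℕ) with h' | h' <;>
      rcases Nat.mod_two_eq_zero_or_one (n - 1 - (i : ℕ)) with h'' | h'' <;>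
        first | omega | simp [h', h'']
    rw [hMs, this]; ring
  have hblock : M.submatrix (locationEquiv n) (exponentEquiv n) = Matrix.fromBlocks
      (Matrix.of fun j k : Fin (n / 2) =>
        ((-1) ^ (n - 1 - (2 * (j : ℕ) + 1)) * 2) *
          x (locationEquiv n (Sum.inl j)) ^ (2 * (k : ℕ) + n % 2)) 0 0
      (Matrix.of fun j k : Fin ((n + 1) / 2) =>
        ((-1) ^ (n - 1 - 2 * (j : ℕ)) * 2) *
          x (locationEquiv n (Sum.inr j)) ^ (2 * (k : ℕ) + (1 - n % 2))) := by
    ext (i | i) (k | k)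
    · exact hM2 _ _ (by simp only [locationEquiv_inl, exponentEquiv_inl]; omega)
    · exact hM0 _ _ (by simp only [locationEquiv_inl, exponentEquiv_inr]; omega)
    · exact hM0 _ _ (by simp only [locationEquiv_inr, exponentEquiv_inl]; omega)
    · exact hM2 _ _ (by simp only [locationEquiv_inr, exponentEquiv_inr]; omega)
  have habs : ∀ (p q : ℕ) (y : ℝ), 0 < y → |(-1 : ℝ) ^ p * 2 * y ^ q| = 2 * y ^ q := by
    intro p q y hy
    rw [abs_mul, abs_mul, abs_neg_one_pow, abs_of_pos (pow_pos hy q)]; norm_num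
  rw [h1, ← abs_of_nonneg (h1 ▸ Finset.sum_nonneg fun _ _ => abs_nonneg _ : 0 ≤ M.det),
    ← Matrix.abs_det_submatrix_equiv_equiv (locationEquiv n) (exponentEquiv n), hblock,
    Matrix.det_fromBlocks_zero₂₁, abs_mul, abs_det_mul_pow, abs_det_mul_pow]
  simp only [habs _ _ _ (h0 _), Finset.prod_mul_distrib, Finset.prod_const, Finset.card_univ,
    Fintype.card_fin]
  have h2 : (2 : ℝ) ^ n = 2 ^ (n / 2) * 2 ^ ((n + 1) / 2) := by
    rw [← pow_add]; congr 1; omega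
  rw [h2]; ring

/-! ### Reduction of symmetric integrals to a fundamental domain -/

/-- If almost every point is moved into `D` by exactly one of the invertible measure preserving
maps `e k`, then an integral is the sum of its pullbacks to `D`. -/
theorem lintegral_eq_sum_setLIntegral_comp {X κ : Type*} [MeasurableSpace X] [Fintype κ]
    {μ : Measure X} {D : Set X} (hD : MeasurableSet D) (e e' : κ → X → X)
    (he : ∀ k, MeasurePreserving (e k) μ μ) (he' : ∀ k, Measurable (e' k))
    (hinv : ∀ k x, e' k (e k x) = x) (huniq : ∀ᵐ x ∂μ, ∃! k, e k x ∈ D)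
    (f : X → ENNReal) (hf : Measurable f) :
    ∫⁻ x, f x ∂μ = ∑ k, ∫⁻ x in D, f (e' k x) ∂μ := by
  classical
  have h1 : ∀ k, ∫⁻ x in D, f (e' k x) ∂μ = ∫⁻ x, (if e k x ∈ D then f x else 0) ∂μ := by
    intro k
    rw [← lintegral_indicator hD, ← (he k).lintegral_comp (f := D.indicator fun x => f (e' k x))
      ((hf.comp (he' k)).indicator hD)]
    refine lintegral_congr fun x => ?_
    simp [Set.indicator_apply, hinv]
  simp only [h1]
  rw [← lintegral_finsetSum]
  · refine lintegral_congr_ae ?_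
    filter_upwards [huniq] with x hx
    obtain ⟨k, hk, hk'⟩ := hx
    rw [Finset.sum_eq_single k]
    · simp [hk]
    · exact fun b _ hb => if_neg fun h => hb (hk' b h)
    · simp
  · exact fun k _ => Measurable.ite ((he k).measurable hD) hf measurable_const

theorem ae_linearMap_ne_zero {n : ℕ} (φ : (Fin n → ℝ) →ₗ[ℝ] ℝ) (hφ : φ ≠ 0) :
    ∀ᵐ x : Fin n → ℝ, φ x ≠ 0 := by
  have h := Measure.addHaar_submodule (volume : Measure (Fin n → ℝ)) (LinearMap.ker φ)
    (by rwa [Ne, LinearMap.ker_eq_top])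
  exact measure_eq_zero_iff_ae_notMem.mp h

theorem ae_injective (n : ℕ) : ∀ᵐ x : Fin n → ℝ, Function.Injective x := by
  have h : ∀ i j : Fin n, i ≠ j → ∀ᵐ x : Fin n → ℝ, x i ≠ x j := by
    intro i j hij
    have := ae_linearMap_ne_zero (LinearMap.proj i - LinearMap.proj (R := ℝ) (φ := fun _ => ℝ) j)
      (fun h => by simpa [hij] using LinearMap.congr_fun h (Pi.single i 1))
    filter_upwards [this] with x hx hx'
    exact hx (by simp [hx'])
  have h' : ∀ᵐ x : Fin n → ℝ, ∀ i j, i ≠ j → x i ≠ x j := by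
    simp only [ae_all_iff]
    exact h
  filter_upwards [h'] with x hx i j hij
  by_contra hne
  exact hx i j hne hij

theorem ae_forall_ne_zero (n : ℕ) : ∀ᵐ x : Fin n → ℝ, ∀ i, x i ≠ 0 := by
  refine ae_all_iff.mpr fun i => ?_
  exact ae_linearMap_ne_zero (LinearMap.proj (R := ℝ) (φ := fun _ => ℝ) i)
    (fun h => by simpa using LinearMap.congr_fun h (Pi.single i 1))

theorem measurePreserving_comp_equiv {ι ι' : Type*} [Fintype ι] [Fintype ι'] (e : ι ≃ ι') :
    MeasurePreserving (fun x : ι' → ℝ => x ∘ e) volume volume :=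
  (volume_measurePreserving_piCongrLeft (fun _ => ℝ) e).symm

theorem strictAnti_comp_perm_iff {n : ℕ} {x : Fin n → ℝ} (hx : Function.Injective x)
    (π : Equiv.Perm (Fin n)) : StrictAnti (x ∘ π) ↔ π = Fin.revPerm.trans (Tuple.sort x) := by
  constructor
  · intro h
    have h1 : Monotone (x ∘ (Fin.revPerm.trans π)) := fun i j hij => by
      simpa using h.antitone (Fin.rev_le_rev.mpr hij)
    have h2 := Tuple.comp_sort_eq_comp_iff_monotone.mpr h1
    ext i
    have := hx (congr_fun h2 i.rev)
    simp only [Equiv.trans_apply, Fin.revPerm_apply, Fin.rev_rev] at this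
    simp [this]
  · rintro rfl
    refine Antitone.strictAnti_of_injective (fun i j hij => ?_)
      (hx.comp (Fin.revPerm.trans (Tuple.sort x)).injective)
    exact Tuple.monotone_sort x (Fin.rev_le_rev.mpr hij)

theorem sortDecreasing_comp_perm {n : ℕ} (x : Fin n → ℝ) (π : Equiv.Perm (Fin n)) :
    sortDecreasing (x ∘ π) = sortDecreasing x := by
  ext i
  exact congr_fun (Tuple.comp_perm_comp_sort_eq_comp_sort (f := x) (σ := π)) i.rev

theorem sortDecreasing_of_strictAnti {n : ℕ} {x : Fin n → ℝ} (hx : StrictAnti x) :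
    sortDecreasing x = x := by
  have h := (strictAnti_comp_perm_iff hx.injective (Equiv.refl _)).mp hx
  ext i
  exact congr_arg x (Equiv.congr_fun h i).symm

theorem measurableSet_strictAnti (n : ℕ) : MeasurableSet {x : Fin n → ℝ | StrictAnti x} := by
  have : {x : Fin n → ℝ | StrictAnti x} = ⋂ i, ⋂ j, ⋂ (_ : i < j), {x | x j < x i} := by
    ext x
    simp [StrictAnti]
  rw [this]
  exact .iInter fun i => .iInter fun j => .iInter fun _ =>
    measurableSet_lt (measurable_pi_apply j) (measurable_pi_apply i)

theorem measurableSet_forall_pos (n : ℕ) : MeasurableSet {x : Fin n → ℝ | ∀ i, 0 < x i} := by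
  simp only [Set.ofPred_forall]
  exact .iInter fun i => measurableSet_lt measurable_const (measurable_pi_apply i)

theorem lintegral_symmetric {n : ℕ} (f : (Fin n → ℝ) → ENNReal) (hf : Measurable f)
    (hsymm : ∀ (π : Equiv.Perm (Fin n)) x, f (x ∘ π) = f x) :
    ∫⁻ x, f x = n.factorial * ∫⁻ x in {x | StrictAnti x}, f x := by
  rw [lintegral_eq_sum_setLIntegral_comp (measurableSet_strictAnti n)
    (fun (π : Equiv.Perm (Fin n)) x => x ∘ π) (fun π x => x ∘ π.symm)
    (fun π => measurePreserving_comp_equiv π)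
    (fun π => (measurePreserving_comp_equiv π.symm).measurable)
    (fun π x => by ext; simp) ?_ f hf]
  · simp [hsymm, Fintype.card_perm]
  · filter_upwards [ae_injective n] with x hx
    simp only [strictAnti_comp_perm_iff hx]
    exact existsUnique_eq

theorem measurePreserving_sign_mul {n : ℕ} (ε : Fin n → ℤˣ) :
    MeasurePreserving (fun (x : Fin n → ℝ) i => signVal (ε i) * x i) volume volume := by
  refine volume_preserving_pi (f := fun i (y : ℝ) => signVal (ε i) * y) fun i => ?_
  rcases Int.units_eq_one_or (ε i) with h | h
  · simpa [signVal, h, Function.id_def] using MeasurePreserving.id (volume : Measure ℝ)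
  · simpa [signVal, h] using Measure.measurePreserving_neg (volume : Measure ℝ)

theorem signVal_mul_self_mul (ε : ℤˣ) (y : ℝ) : signVal ε * (signVal ε * y) = y := by
  rcases Int.units_eq_one_or ε with rfl | rfl <;> simp [signVal]

theorem existsUnique_sign_mul_pos {n : ℕ} {x : Fin n → ℝ} (hx : ∀ i, x i ≠ 0) :
    ∃! ε : Fin n → ℤˣ, ∀ i, 0 < signVal (ε i) * x i := by
  refine ⟨fun i => if 0 < x i then 1 else -1, fun i => ?_, fun ε hε => ?_⟩
  · dsimp only
    split_ifs with h
    · simpa [signVal] using h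
    · simpa [signVal] using lt_of_le_of_ne (not_lt.mp h) (hx i)
  · ext1 i
    have := hε i
    rcases Int.units_eq_one_or (ε i) with h | h
    · simp only [h, signVal, Units.val_one, Int.cast_one, one_mul] at this
      simp [h, this]
    · simp only [h, signVal, Units.val_neg, Units.val_one, Int.cast_neg, Int.cast_one,
        neg_mul, one_mul, Left.neg_pos_iff] at this
      simp [h, this.le]

/-- The integral of a function that is symmetric under permutations, folded onto the positive Weyl
chamber by the reflections `x_i ↦ -x_i` and the permutations of the coordinates. -/
theorem lintegral_symmetric_signs {n : ℕ} (f : (Fin n → ℝ) → ENNReal) (hf : Measurable f)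
    (hsymm : ∀ (π : Equiv.Perm (Fin n)) x, f (x ∘ π) = f x) :
    ∫⁻ x, f x = n.factorial * ∫⁻ x in {x | StrictAnti x ∧ ∀ i, 0 < x i},
      ∑ ε : Fin n → ℤˣ, f fun i => signVal (ε i) * x i := by
  have hm : ∀ ε : Fin n → ℤˣ, Measurable fun (x : Fin n → ℝ) => f fun i => signVal (ε i) * x i :=
    fun ε => hf.comp (measurePreserving_sign_mul ε).measurable
  have hpos := measurableSet_forall_pos n
  rw [lintegral_eq_sum_setLIntegral_comp hpos
    (fun (ε : Fin n → ℤˣ) x i => signVal (ε i) * x i) (fun ε x i => signVal (ε i) * x i)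
    measurePreserving_sign_mul (fun ε => (measurePreserving_sign_mul ε).measurable)
    (fun ε x => by ext; simp only [signVal_mul_self_mul]) ?_ f hf]
  · rw [← lintegral_finsetSum _ fun ε _ => hm ε, ← lintegral_indicator hpos,
      lintegral_symmetric]
    · rw [setLIntegral_indicator hpos]
      congr 3
      ext x
      simp [and_comm]
    · exact (Finset.measurable_fun_sum _ fun ε _ => hm ε).indicator hpos
    · intro π x
      have h1 : (x ∘ π ∈ {x : Fin n → ℝ | ∀ i, 0 < x i}) ↔ x ∈ {x : Fin n → ℝ | ∀ i, 0 < x i} :=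
        π.forall_congr_right (q := fun i => 0 < x i)
      simp only [Set.indicator_apply, h1]
      congr 1
      refine Fintype.sum_equiv (π.arrowCongr (Equiv.refl _)) _ _ fun ε => ?_
      rw [← hsymm π fun i => signVal (π.arrowCongr (Equiv.refl _) ε i) * x i]
      congr 1
      ext i
      simp [Equiv.arrowCongr]
  · filter_upwards [ae_forall_ne_zero n] with x hx
    exact existsUnique_sign_mul_pos hx

/-! ### Determinants of moments over interlacing intervals -/

/-- An even weight `w` on `ℝ` of order `n`: its moments up to `n - 1` exist, and the functions
`W(u) u ^ j`, `j ≤ n - 2`, of the companion `W` vanish at infinity with derivatives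
`c⁻¹ (j c u ^ (j - 1) - u ^ (j + 1)) w(u)` on `(0, ∞)`, where `c > 0` may depend on `j`. The latter
is recorded in integrated form. For `j = 0` the exponent `j - 1` is truncated, but the coefficient
of that term vanishes. -/
structure IsEvenWeightWithCompanion (n : ℕ) (w W : ℝ → ℝ) : Prop where
  measurable : Measurable w
  nonneg : ∀ x, 0 ≤ w x
  even : ∀ x, w (-x) = w x
  pos : ∀ x ∈ Set.Ioo (0 : ℝ) 1, 0 < w x
  integrableOn : ∀ j < n, IntegrableOn (fun s => s ^ j * w s) (Set.Ioi 0)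
  companion_measurable : Measurable W
  companion_nonneg : ∀ u, 0 ≤ W u
  integral_Ioi : ∀ j, j + 2 ≤ n → ∃ c > 0, ∀ u ≥ 0,
    ∫ s in Set.Ioi u, (s ^ (j + 1) - j * c * s ^ (j - 1)) * w s = c * W u * u ^ j

/-- The intervals `(τ 0, ∞)`, `(τ 1, τ 0)`, `(τ 2, τ 1)`, … cut out by a decreasing sequence. -/
def interlacingInterval (τ : ℕ → ℝ) : ℕ → Set ℝ
  | 0 => Set.Ioi (τ 0)
  | i + 1 => Set.Ioo (τ (i + 1)) (τ i)

theorem measurableSet_interlacingInterval (τ : ℕ → ℝ) (i : ℕ) :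
    MeasurableSet (interlacingInterval τ i) := by
  cases i
  · exact measurableSet_Ioi
  · exact measurableSet_Ioo

theorem interlacingInterval_subset (τ : ℕ → ℝ) (i : ℕ) :
    interlacingInterval τ i ⊆ Set.Ioi (τ i) := by
  cases i
  · exact subset_rfl
  · exact Set.Ioo_subset_Ioi_self

theorem integrable_det_pi {N : ℕ} {ν : Fin N → Measure ℝ} [∀ i, SigmaFinite (ν i)]
    (f : Fin N → ℝ → ℝ) (hf : ∀ i k, Integrable (f k) (ν i)) :
    Integrable (fun x : Fin N → ℝ => (Matrix.of fun i k => f k (x i)).det) (Measure.pi ν) := by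
  simp only [← Matrix.det_transpose (Matrix.of _), Matrix.det_apply', Matrix.transpose_apply,
    Matrix.of_apply]
  exact integrable_finsetSum _ fun σ _ =>
    (Integrable.fintype_prod (f := fun i => f (σ i)) fun i => hf i (σ i)).const_mul _

/-- The integral of a determinant whose rows depend on separate variables is the determinant of
the integrals. -/
theorem integral_det_pi {N : ℕ} {ν : Fin N → Measure ℝ} [∀ i, SigmaFinite (ν i)]
    (f : Fin N → ℝ → ℝ) (hf : ∀ i k, Integrable (f k) (ν i)) :
    ∫ x, (Matrix.of fun i k => f k (x i)).det ∂(Measure.pi ν) =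
      (Matrix.of fun i k => ∫ s, f k s ∂(ν i)).det := by
  simp only [← Matrix.det_transpose (Matrix.of _), Matrix.det_apply', Matrix.transpose_apply,
    Matrix.of_apply]
  rw [integral_finsetSum _ fun σ _ =>
    (Integrable.fintype_prod (f := fun i => f (σ i)) fun i => hf i (σ i)).const_mul _]
  refine Finset.sum_congr rfl fun σ _ => ?_
  rw [integral_const_mul, integral_fintype_prod_eq_prod (fun i => f (σ i))]

/-- On a region where the sign of `g` is constant, the integral of `|g|` is the absolute value of
the integral of `g`. -/
theorem lintegral_ofReal_abs_of_sign {X : Type*} [MeasurableSpace X] {μ : Measure X} {g : X → ℝ}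
    (hg : Integrable g μ) {σ : ℝ} (hσ : |σ| = 1) (h : ∀ᵐ x ∂μ, |g x| = σ * g x) :
    ∫⁻ x, ENNReal.ofReal |g x| ∂μ = ENNReal.ofReal |∫ x, g x ∂μ| := by
  rw [← ofReal_integral_eq_lintegral_ofReal hg.abs (.of_forall fun _ => abs_nonneg _),
    ← one_mul |∫ x, g x ∂μ|, ← hσ, ← abs_mul, ← integral_const_mul, ← integral_congr_ae h,
    abs_of_nonneg (integral_nonneg fun _ => abs_nonneg _)]

/-- Adding up consecutive rows turns integrals over the interlacing intervals into integrals over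
half-lines. -/
theorem det_integral_interlacing {N : ℕ} {τ : ℕ → ℝ} (hτ : Antitone τ) (h0 : ∀ i, 0 ≤ τ i)
    (f : Fin N → ℝ → ℝ) (hf : ∀ k, IntegrableOn (f k) (Set.Ioi 0)) :
    (Matrix.of fun i k : Fin N => ∫ s in interlacingInterval τ i, f k s).det =
      (Matrix.of fun i k : Fin N => ∫ s in Set.Ioi (τ i), f k s).det := by
  cases N with
  | zero => simp
  | succ N =>
    symm
    refine Matrix.det_eq_of_forall_row_eq_smul_add_pred (fun _ => 1) (fun k => ?_) fun i k => ?_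
    · simp only [Matrix.of_apply, Fin.val_zero, interlacingInterval]
    have hi := fun i => (hf k).mono_set (Set.Ioi_subset_Ioi (h0 i))
    simp only [Matrix.of_apply, Fin.val_succ, Fin.val_castSucc, one_mul, interlacingInterval]
    have hle : τ (i + 1) ≤ τ i := hτ (Nat.le_succ _)
    rw [← integral_Ioc_eq_integral_Ioo, ← Set.Ioc_union_Ioi_eq_Ioi hle,
      setIntegral_union (Set.Ioc_disjoint_Ioi le_rfl) measurableSet_Ioi
        ((hi (i + 1)).mono_set Set.Ioc_subset_Ioi_self) (hi i)]

namespace IsEvenWeightWithCompanion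

variable {n : ℕ} {w W : ℝ → ℝ}

theorem integral_pow_succ (h : IsEvenWeightWithCompanion n w W) {j : ℕ} (hj : j + 2 ≤ n) {c : ℝ}
    (hc : ∀ u ≥ 0, ∫ s in Set.Ioi u, (s ^ (j + 1) - j * c * s ^ (j - 1)) * w s =
      c * W u * u ^ j) {u : ℝ} (hu : 0 ≤ u) :
    ∫ s in Set.Ioi u, s ^ (j + 1) * w s =
      c * W u * u ^ j + j * c * ∫ s in Set.Ioi u, s ^ (j - 1) * w s := by
  have hi : ∀ k < n, IntegrableOn (fun s => s ^ k * w s) (Set.Ioi u) := fun k hk =>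
    (h.integrableOn k hk).mono_set (Set.Ioi_subset_Ioi hu)
  rw [← hc u hu, ← integral_const_mul, ← integral_add]
  · refine integral_congr_ae (.of_forall fun s => ?_)
    dsimp only
    ring
  · refine ((hi (j + 1) (by omega)).sub ((hi (j - 1) (by omega)).const_mul (j * c))).congr
      (.of_forall fun s => ?_)
    simp only [Pi.sub_apply]
    ring
  · exact (hi (j - 1) (by omega)).const_mul (j * c)

theorem integral_Ioi_zero_pos (h : IsEvenWeightWithCompanion n w W) (hn : 0 < n) :
    0 < ∫ s in Set.Ioi 0, w s := by
  have hi : IntegrableOn w (Set.Ioi 0) := by simpa using h.integrableOn 0 hn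
  rw [setIntegral_pos_iff_support_of_nonneg_ae (.of_forall h.nonneg) hi]
  refine lt_of_lt_of_le (b := volume (Set.Ioo (0 : ℝ) 1)) (by simp) (measure_mono fun x hx => ?_)
  exact ⟨(h.pos x hx).ne', hx.1⟩

/-- For even order, the determinant of the odd moments over half-lines is a Vandermonde
determinant, because column operations turn each moment into the companion times a monomial. -/
theorem abs_det_moments_even {m : ℕ} (h : IsEvenWeightWithCompanion (2 * m) w W) :
    ∃ K > 0, ∀ τ : ℕ → ℝ, (∀ i, 0 ≤ τ i) →
      |(Matrix.of fun i k : Fin m => ∫ s in Set.Ioi (τ i), s ^ (2 * (k : ℕ) + 1) * w s).det| =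
        K * ((∏ i : Fin m, W (τ i)) * |vandermondeDet fun i : Fin m => τ i ^ 2|) := by
  choose! c hc0 hc using h.integral_Ioi
  refine ⟨∏ k : Fin m, c (2 * k), Finset.prod_pos fun k _ => hc0 _ (by omega), fun τ h0 => ?_⟩
  have key : (Matrix.of fun i k : Fin m =>
      ∫ s in Set.Ioi (τ i), s ^ (2 * (k : ℕ) + 1) * w s).det =
      (Matrix.of fun i k : Fin m => c (2 * k) * (W (τ i) * τ i ^ (2 * (k : ℕ)))).det := by
    cases m with
    | zero => simp
    | succ m =>
      refine Matrix.det_eq_of_forall_col_eq_smul_add_pred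
        (fun k => (2 * (k + 1) : ℕ) * c (2 * (k + 1))) (fun i => ?_) fun i k => ?_
      · have := h.integral_pow_succ (j := 0) (by omega) (hc 0 (by omega)) (h0 i)
        simpa [mul_assoc] using this
      · have := h.integral_pow_succ (j := 2 * (k + 1)) (by omega) (hc _ (by omega)) (h0 i)
        have e : 2 * ((k : ℕ) + 1) - 1 = 2 * k + 1 := by omega
        simpa [mul_assoc, e] using this
  have hrow := Matrix.det_mul_row (fun k : Fin m => c (2 * k))
    (Matrix.of fun i k : Fin m => W (τ i) * τ i ^ (2 * (k : ℕ)))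
  simp only [Matrix.of_apply] at hrow
  rw [key, hrow, abs_mul,
    abs_of_pos (Finset.prod_pos fun k _ => hc0 _ (by omega))]
  have := abs_det_mul_pow (fun i : Fin m => W (τ i)) (fun i : Fin m => τ i) 0
  simp only [add_zero, pow_zero, mul_one, abs_of_nonneg (h.companion_nonneg _)] at this
  rw [this]

/-- For odd order, the determinant of the even moments over half-lines, the last of which is
`(0, ∞)`: column operations turn all but the zeroth moments into the companion times an odd
monomial, which vanishes in the last row. -/
theorem abs_det_moments_odd {m : ℕ} (h : IsEvenWeightWithCompanion (2 * m + 1) w W) :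
    ∃ K > 0, ∀ τ : ℕ → ℝ, (∀ i, 0 ≤ τ i) → τ m = 0 →
      |(Matrix.of fun i k : Fin (m + 1) => ∫ s in Set.Ioi (τ i), s ^ (2 * (k : ℕ)) * w s).det| =
        K * ((∏ i : Fin m, W (τ i) * τ i) * |vandermondeDet fun i : Fin m => τ i ^ 2|) := by
  choose! c hc0 hc using h.integral_Ioi
  have hI := h.integral_Ioi_zero_pos (by omega)
  refine ⟨(∫ s in Set.Ioi 0, w s) * ∏ k : Fin m, c (2 * k + 1),
    mul_pos hI (Finset.prod_pos fun k _ => hc0 _ (by omega)), fun τ h0 hm => ?_⟩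
  set B : Matrix (Fin (m + 1)) (Fin (m + 1)) ℝ := Matrix.of fun i =>
    Fin.cons (∫ s in Set.Ioi (τ i), w s)
      fun k : Fin m => c (2 * k + 1) * (W (τ i) * τ i ^ (2 * (k : ℕ) + 1)) with hB
  have key : (Matrix.of fun i k : Fin (m + 1) =>
      ∫ s in Set.Ioi (τ i), s ^ (2 * (k : ℕ)) * w s).det = B.det := by
    refine Matrix.det_eq_of_forall_col_eq_smul_add_pred
      (fun k => (2 * k + 1 : ℕ) * c (2 * k + 1)) (fun i => ?_) fun i k => ?_
    · simp [hB]
    · have := h.integral_pow_succ (j := 2 * k + 1) (by omega) (hc _ (by omega)) (h0 i)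
      simpa [hB, mul_assoc, mul_add] using this
  -- Since `τ m = 0`, only the zeroth moment survives in the last row, along which `B` is expanded.
  have hlast : ∀ k : Fin m, B (Fin.last m) k.succ = 0 := fun k => by simp [hB, hm]
  have hsub : B.submatrix (Fin.last m).succAbove (0 : Fin (m + 1)).succAbove =
      Matrix.of fun i k : Fin m => c (2 * k + 1) * (W (τ i) * τ i ^ (2 * (k : ℕ) + 1)) := by
    ext i k
    simp [hB]
  rw [key, Matrix.det_succ_row B (Fin.last m), Fin.sum_univ_succ]
  simp only [hlast, mul_zero, zero_mul, Finset.sum_const_zero, add_zero]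
  have hrow := Matrix.det_mul_row (fun k : Fin m => c (2 * k + 1))
    (Matrix.of fun i k : Fin m => W (τ i) * τ i ^ (2 * (k : ℕ) + 1))
  simp only [Matrix.of_apply] at hrow
  rw [hsub, abs_mul, abs_mul, abs_neg_one_pow, one_mul, hrow, abs_mul,
    abs_of_pos (Finset.prod_pos fun k _ => hc0 _ (by omega)), abs_det_mul_pow]
  have hB0 : B (Fin.last m) 0 = ∫ s in Set.Ioi 0, w s := by simp [hB, hm]
  have hp : ∏ i : Fin m, |W (τ i) * τ i ^ 1| = ∏ i : Fin m, W (τ i) * τ i :=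
    Finset.prod_congr rfl fun i _ => by
      rw [pow_one, abs_of_nonneg (mul_nonneg (h.companion_nonneg _) (h0 _))]
  rw [hB0, abs_of_pos hI, hp]
  ring

/-- The integral over the odd locations `o`, interlacing with the even locations `τ`. -/
theorem lintegral_interlacing (h : IsEvenWeightWithCompanion n w W) {m N : ℕ} (hm : n / 2 = m)
    (hN : (n + 1) / 2 = N) :
    ∃ K > 0, ∀ τ : ℕ → ℝ, Antitone τ → (∀ i, 0 ≤ τ i) → τ m = 0 →
      ∫⁻ o in Set.univ.pi fun i : Fin N => interlacingInterval τ i,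
        ENNReal.ofReal ((∏ i, w (o i) * o i ^ (1 - n % 2)) * |vandermondeDet fun i => o i ^ 2|) =
      ENNReal.ofReal
        (K * ((∏ i : Fin m, W (τ i) * τ i ^ (n % 2)) * |vandermondeDet fun i : Fin m => τ i ^ 2|))
    := by
  have hdet : ∃ K > 0, ∀ τ : ℕ → ℝ, (∀ i, 0 ≤ τ i) → τ m = 0 →
      |(Matrix.of fun i k : Fin N =>
          ∫ s in Set.Ioi (τ i), s ^ (2 * (k : ℕ) + (1 - n % 2)) * w s).det| =
        K * ((∏ i : Fin m, W (τ i) * τ i ^ (n % 2)) *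
          |vandermondeDet fun i : Fin m => τ i ^ 2|) := by
    rcases Nat.mod_two_eq_zero_or_one n with hn | hn
    · obtain rfl : n = 2 * m := by omega
      obtain rfl : m = N := by omega
      obtain ⟨K, hK, H⟩ := h.abs_det_moments_even
      exact ⟨K, hK, fun τ h0 _ => by simpa [hn] using H τ h0⟩
    · obtain rfl : n = 2 * m + 1 := by omega
      obtain rfl : m + 1 = N := by omega
      obtain ⟨K, hK, H⟩ := h.abs_det_moments_odd
      exact ⟨K, hK, fun τ h0 hτ => by simpa [hn] using H τ h0 hτ⟩
  obtain ⟨K, hK, H⟩ := hdet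
  refine ⟨K, hK, fun τ hτ h0 hτm => ?_⟩
  set f : Fin N → ℝ → ℝ := fun k s => s ^ (2 * (k : ℕ) + (1 - n % 2)) * w s with hf
  have hfi : ∀ k, IntegrableOn (f k) (Set.Ioi 0) := fun k => h.integrableOn _ (by omega)
  have hI : ∀ i, interlacingInterval τ i ⊆ Set.Ioi 0 := fun i =>
    (interlacingInterval_subset τ i).trans (Set.Ioi_subset_Ioi (h0 i))
  have hfI : ∀ i k : Fin N, Integrable (f k) (volume.restrict (interlacingInterval τ i)) :=
    fun i k => (hfi k).mono_set (hI i)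
  have hbox : MeasurableSet (Set.univ.pi fun i : Fin N => interlacingInterval τ i) :=
    .univ_pi fun i => measurableSet_interlacingInterval τ i
  have hfac : ∀ o : Fin N → ℝ, (Matrix.of fun i k => f k (o i)).det =
      (∏ i, w (o i) * o i ^ (1 - n % 2)) * vandermondeDet fun i => o i ^ 2 := by
    intro o
    rw [vandermondeDet, ← Matrix.det_mul_column]
    congr 1
    ext i k
    simp only [hf, Matrix.of_apply, Matrix.vandermonde_apply]
    ring
  have hpos : ∀ o ∈ Set.univ.pi fun i : Fin N => interlacingInterval τ i, ∀ i, 0 < o i :=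
    fun o ho i => hI i (ho i trivial)
  have hanti : ∀ o ∈ Set.univ.pi fun i : Fin N => interlacingInterval τ i,
      StrictAnti fun i => o i ^ 2 := by
    intro o ho i j hij
    refine pow_lt_pow_left₀ ?_ (hpos o ho j).le two_ne_zero
    have hj : o j ∈ interlacingInterval τ j := ho j trivial
    have hi := interlacingInterval_subset τ i (ho i trivial)
    obtain ⟨l, hl⟩ : ∃ l, (j : ℕ) = l + 1 := ⟨j - 1, by omega⟩
    rw [hl] at hj
    exact hj.2.trans_le ((hτ (by omega)).trans (le_of_lt hi))
  have hnn : ∀ o ∈ Set.univ.pi fun i : Fin N => interlacingInterval τ i,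
      0 ≤ ∏ i, w (o i) * o i ^ (1 - n % 2) := fun o ho =>
    Finset.prod_nonneg fun i _ => mul_nonneg (h.nonneg _) (pow_nonneg (hpos o ho i).le _)
  -- On the box the entries of `o` decrease, so the Vandermonde determinant has a constant sign.
  set σ : ℝ := ∏ i : Fin N, (-1 : ℝ) ^ (Finset.Ioi i).card with hσ
  have hσ1 : |σ| = 1 := by simp [hσ, Finset.abs_prod]
  have hrestrict : volume.restrict (Set.univ.pi fun i : Fin N => interlacingInterval τ i) =
      Measure.pi fun i : Fin N => volume.restrict (interlacingInterval τ i) := by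
    rw [volume_pi, Measure.restrict_pi_pi]
  have habs : ∫⁻ o in Set.univ.pi fun i : Fin N => interlacingInterval τ i,
      ENNReal.ofReal ((∏ i, w (o i) * o i ^ (1 - n % 2)) * |vandermondeDet fun i => o i ^ 2|) =
      ∫⁻ o in Set.univ.pi fun i : Fin N => interlacingInterval τ i,
        ENNReal.ofReal |(Matrix.of fun i k => f k (o i)).det| := by
    refine setLIntegral_congr_fun hbox fun o ho => ?_
    rw [hfac, abs_mul, abs_of_nonneg (hnn o ho)]
  rw [habs, lintegral_ofReal_abs_of_sign (σ := σ) _ hσ1, hrestrict, integral_det_pi f hfI,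
    det_integral_interlacing hτ h0 f hfi, H τ h0 hτm]
  · rw [ae_restrict_iff' hbox]
    refine .of_forall fun o ho => ?_
    rw [hfac, abs_mul, abs_of_nonneg (hnn o ho), abs_vandermondeDet_of_strictAnti _ (hanti o ho)]
    ring
  · rw [hrestrict]
    exact integrable_det_pi f hfI

end IsEvenWeightWithCompanion

/-! ### Splitting the Weyl chamber into even and odd locations -/

/-- The positive Weyl chamber `x₁ > x₂ > ⋯ > xₙ > 0`. -/
def positiveChamber (n : ℕ) : Set (Fin n → ℝ) := {x | StrictAnti x ∧ ∀ i, 0 < x i}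

theorem measurableSet_positiveChamber (n : ℕ) : MeasurableSet (positiveChamber n) :=
  (measurableSet_strictAnti n).inter (measurableSet_forall_pos n)

/-- A finite tuple continued by zeros. -/
noncomputable def extendByZero {m : ℕ} (t : Fin m → ℝ) (i : ℕ) : ℝ :=
  if h : i < m then t ⟨i, h⟩ else 0

@[simp] theorem extendByZero_val {m : ℕ} (t : Fin m → ℝ) (i : Fin m) : extendByZero t i = t i := by
  simp [extendByZero]

theorem extendByZero_of_lt {m : ℕ} (t : Fin m → ℝ) {i : ℕ} (h : i < m) :
    extendByZero t i = t ⟨i, h⟩ := by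
  simp [extendByZero, h]

theorem extendByZero_of_le {m : ℕ} (t : Fin m → ℝ) {i : ℕ} (h : m ≤ i) : extendByZero t i = 0 := by
  simp [extendByZero, h]

theorem extendByZero_nonneg {m : ℕ} {t : Fin m → ℝ} (ht : t ∈ positiveChamber m) (i : ℕ) :
    0 ≤ extendByZero t i := by
  unfold extendByZero
  split_ifs with h
  · exact (ht.2 _).le
  · rfl

theorem antitone_extendByZero {m : ℕ} {t : Fin m → ℝ} (ht : t ∈ positiveChamber m) :
    Antitone (extendByZero t) := by
  intro i j hij
  rcases lt_or_ge j m with hj | hj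
  · rw [extendByZero_of_lt t hj, extendByZero_of_lt t (hij.trans_lt hj)]
    exact ht.1.antitone hij
  · rw [extendByZero_of_le t hj]
    exact extendByZero_nonneg ht i

theorem lt_of_mem_interlacingInterval {τ : ℕ → ℝ} (hτ : Antitone τ) {i j : ℕ} (hij : i < j) {y : ℝ}
    (hy : y ∈ interlacingInterval τ j) : y < τ i := by
  obtain ⟨l, rfl⟩ : ∃ l, j = l + 1 := ⟨j - 1, by omega⟩
  exact hy.2.trans_le (hτ (by omega))

/-- The tuple with the entries `t` at the even and `o` at the odd locations. -/
noncomputable def mergeLocations {n : ℕ} (p : (Fin (n / 2) → ℝ) × (Fin ((n + 1) / 2) → ℝ)) :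
    Fin n → ℝ :=
  Sum.elim p.1 p.2 ∘ (locationEquiv n).symm

@[simp] theorem mergeLocations_inl {n : ℕ} (p : (Fin (n / 2) → ℝ) × (Fin ((n + 1) / 2) → ℝ))
    (j : Fin (n / 2)) : mergeLocations p (locationEquiv n (Sum.inl j)) = p.1 j := by
  simp [mergeLocations]

@[simp] theorem mergeLocations_inr {n : ℕ} (p : (Fin (n / 2) → ℝ) × (Fin ((n + 1) / 2) → ℝ))
    (i : Fin ((n + 1) / 2)) : mergeLocations p (locationEquiv n (Sum.inr i)) = p.2 i := by
  simp [mergeLocations]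

theorem evenLocations_mergeLocations {n : ℕ}
    (p : (Fin (n / 2) → ℝ) × (Fin ((n + 1) / 2) → ℝ)) : evenLocations (mergeLocations p) = p.1 :=
  funext fun j => mergeLocations_inl p j

theorem measurePreserving_mergeLocations (n : ℕ) :
    MeasurePreserving (mergeLocations (n := n)) volume volume := by
  have h := (measurePreserving_comp_equiv (locationEquiv n).symm).comp
    (volume_measurePreserving_sumPiEquivProdPi_symm
      fun _ : Fin (n / 2) ⊕ Fin ((n + 1) / 2) => ℝ)
  convert h using 1
  ext p i
  simp only [mergeLocations, Function.comp_apply]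
  cases (locationEquiv n).symm i <;> rfl

/-- The merged tuple is positive and decreasing if and only if the even locations are, and the odd
locations interlace with them. -/
theorem mergeLocations_mem_positiveChamber_iff {n : ℕ} (t : Fin (n / 2) → ℝ)
    (o : Fin ((n + 1) / 2) → ℝ) :
    mergeLocations (t, o) ∈ positiveChamber n ↔ t ∈ positiveChamber (n / 2) ∧
      o ∈ Set.univ.pi fun i : Fin ((n + 1) / 2) => interlacingInterval (extendByZero t) i := by
  set x := mergeLocations (t, o) with hx
  have ht : ∀ j, t j = x (locationEquiv n (Sum.inl j)) := fun j =>
    (mergeLocations_inl (t, o) j).symm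
  have ho : ∀ i, o i = x (locationEquiv n (Sum.inr i)) := fun i =>
    (mergeLocations_inr (t, o) i).symm
  constructor
  · rintro ⟨hanti, hpos⟩
    have hτ : ∀ i : Fin ((n + 1) / 2), extendByZero t i < o i := by
      intro i
      rcases lt_or_ge (i : ℕ) (n / 2) with h | h
      · rw [extendByZero_of_lt t h, ht, ho]
        exact hanti (Fin.lt_def.mpr (by simp))
      · rw [extendByZero_of_le t h, ho]
        exact hpos _
    refine ⟨⟨fun i j hij => ?_, fun i => ?_⟩, fun i _ => ?_⟩
    · rw [ht, ht]
      exact hanti (Fin.lt_def.mpr (by simpa using hij))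
    · rw [ht]
      exact hpos _
    · have h1 := hτ i
      obtain ⟨i, hi⟩ := i
      cases i with
      | zero => exact h1
      | succ i =>
        refine ⟨h1, ?_⟩
        rw [extendByZero_of_lt t (show i < n / 2 by omega), ht, ho]
        exact hanti (Fin.lt_def.mpr (by simp; omega))
  · rintro ⟨htc, hoI⟩
    have hτ := antitone_extendByZero htc
    have hI : ∀ i : Fin ((n + 1) / 2), o i ∈ interlacingInterval (extendByZero t) i :=
      fun i => hoI i trivial
    have hlow : ∀ i : Fin ((n + 1) / 2), extendByZero t i < o i := fun i =>
      interlacingInterval_subset _ _ (hI i)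
    constructor
    · intro i j hij
      obtain ⟨a, rfl⟩ := (locationEquiv n).surjective i
      obtain ⟨b, rfl⟩ := (locationEquiv n).surjective j
      rw [Fin.lt_def] at hij
      rcases a with a | a <;> rcases b with b | b <;>
        simp only [locationEquiv_inl, locationEquiv_inr] at hij <;> simp only [← ht, ← ho]
      · exact htc.1 (Fin.lt_def.mpr (by omega))
      · simpa using lt_of_mem_interlacingInterval (i := a) hτ (by omega) (hI b)
      · have h1 : extendByZero t b ≤ extendByZero t a := hτ (by omega)
        exact lt_of_le_of_lt (by simpa using h1) (hlow a)
      · exact (lt_of_mem_interlacingInterval (i := a) hτ (by omega) (hI b)).trans (hlow a)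
    · intro i
      obtain ⟨a, rfl⟩ := (locationEquiv n).surjective i
      rcases a with a | a <;> simp only [← ht, ← ho]
      · exact htc.2 a
      · exact (extendByZero_nonneg htc _).trans_lt (hlow a)

/-! ### Decimation of the singular values -/

theorem measurable_vandermondeDet (n : ℕ) : Measurable (vandermondeDet (n := n)) := by
  unfold vandermondeDet
  simp only [Matrix.det_vandermonde]
  fun_prop

theorem abs_vandermondeDet_comp_perm {n : ℕ} (x : Fin n → ℝ) (π : Equiv.Perm (Fin n)) :
    |vandermondeDet (x ∘ π)| = |vandermondeDet x| := by
  have h : Matrix.vandermonde (x ∘ π) = (Matrix.vandermonde x).submatrix π (Equiv.refl _) := rfl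
  rw [vandermondeDet, h, Matrix.abs_det_submatrix_equiv_equiv, vandermondeDet]

theorem measurable_evenLocations_singularValues (n : ℕ) :
    Measurable fun x : Fin n → ℝ => evenLocations (singularValues x) := by
  refine measurable_pi_lambda _ fun j => ?_
  refine (measurable_pi_apply _).comp ((measurable_sortDecreasing n).comp ?_)
  exact measurable_pi_lambda _ fun k => (measurable_pi_apply k).abs

theorem singularValues_comp_perm {n : ℕ} (x : Fin n → ℝ) (π : Equiv.Perm (Fin n)) :
    singularValues (x ∘ π) = singularValues x :=
  sortDecreasing_comp_perm (fun k => |x k|) π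

theorem singularValues_sign_mul {n : ℕ} {x : Fin n → ℝ} (hx : x ∈ positiveChamber n)
    (ε : Fin n → ℤˣ) : (singularValues fun i => signVal (ε i) * x i) = x := by
  have : (fun i => |signVal (ε i) * x i|) = x := by
    ext i
    rw [abs_mul, abs_signVal, one_mul, abs_of_pos (hx.2 i)]
  rw [singularValues, this, sortDecreasing_of_strictAnti hx.1]

namespace IsEvenWeightWithCompanion

variable {n : ℕ} {w W : ℝ → ℝ}

theorem apply_sign_mul (h : IsEvenWeightWithCompanion n w W) (ε : ℤˣ) (y : ℝ) :
    w (signVal ε * y) = w y := by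
  rcases Int.units_eq_one_or ε with rfl | rfl <;> simp [signVal, h.even]

/-- The density of the singular values on the positive Weyl chamber, with the even locations `t` and
the odd locations `o` separated. -/
theorem sum_density_sign_mul (h : IsEvenWeightWithCompanion n w W) {x : Fin n → ℝ}
    (hx : x ∈ positiveChamber n) {t : Fin (n / 2) → ℝ} {o : Fin ((n + 1) / 2) → ℝ}
    (hxe : x = mergeLocations (t, o)) :
    ∑ ε : Fin n → ℤˣ, (∏ k, w (signVal (ε k) * x k)) *
        |vandermondeDet fun i => signVal (ε i) * x i| =
      (2 ^ n * ((∏ j, w (t j) * t j ^ (n % 2)) * |vandermondeDet fun j => t j ^ 2|)) *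
        ((∏ i, w (o i) * o i ^ (1 - n % 2)) * |vandermondeDet fun i => o i ^ 2|) := by
  simp only [h.apply_sign_mul]
  rw [← Finset.mul_sum, sum_abs_vandermondeDet_sign x hx.1 hx.2,
    ← (locationEquiv n).prod_comp fun k => w (x k), Fintype.prod_sum_type]
  simp only [hxe, mergeLocations_inl, mergeLocations_inr, Finset.prod_mul_distrib]
  ring

/-- Folding onto the positive Weyl chamber and integrating out the odd locations. -/
theorem lintegral_evenLocations (h : IsEvenWeightWithCompanion n w W) :
    ∃ C > 0, ∀ F : (Fin (n / 2) → ℝ) → ENNReal, Measurable F →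
      ∫⁻ x : Fin n → ℝ, F (evenLocations (singularValues x)) *
          ENNReal.ofReal ((∏ k, w (x k)) * |vandermondeDet x|) =
        ENNReal.ofReal C * ∫⁻ t in positiveChamber (n / 2), F t *
          ENNReal.ofReal ((∏ j, t j ^ (2 * (n % 2)) * (w (t j) * W (t j))) *
            vandermondeDet (fun j => t j ^ 2) ^ 2) := by
  obtain ⟨K, hK, H⟩ := h.lintegral_interlacing rfl rfl
  refine ⟨n.factorial * (2 ^ n * K), by positivity, fun F hF => ?_⟩
  have hw := h.measurable
  set A : (Fin (n / 2) → ℝ) → ℝ := fun t =>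
    (∏ j, w (t j) * t j ^ (n % 2)) * |vandermondeDet fun j => t j ^ 2| with hA
  set B : (Fin ((n + 1) / 2) → ℝ) → ℝ := fun o =>
    (∏ i, w (o i) * o i ^ (1 - n % 2)) * |vandermondeDet fun i => o i ^ 2| with hB
  have hsq : ∀ N, Measurable fun (x : Fin N → ℝ) => |vandermondeDet fun i => x i ^ 2| := fun N =>
    ((measurable_vandermondeDet N).comp (by fun_prop)).abs
  have hAm : Measurable A := by
    have := hsq (n / 2)
    fun_prop
  have hBm : Measurable B := by
    have := hsq ((n + 1) / 2)
    fun_prop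
  have hdm : Measurable fun x : Fin n → ℝ =>
      ENNReal.ofReal ((∏ k, w (x k)) * |vandermondeDet x|) := by
    have := (measurable_vandermondeDet n).abs
    fun_prop
  have hA0 : ∀ t ∈ positiveChamber (n / 2), 0 ≤ A t := fun t ht => mul_nonneg
    (Finset.prod_nonneg fun j _ => mul_nonneg (h.nonneg _) (pow_nonneg (ht.2 j).le _))
    (abs_nonneg _)
  rw [lintegral_symmetric_signs]
  rotate_left
  · exact (hF.comp (measurable_evenLocations_singularValues n)).mul hdm
  · intro π x
    have : ∏ k, w ((x ∘ π) k) = ∏ k, w (x k) := Equiv.prod_comp π fun k => w (x k)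
    rw [singularValues_comp_perm, abs_vandermondeDet_comp_perm, this]
  have hfold : ∫⁻ x in {x : Fin n → ℝ | StrictAnti x ∧ ∀ i, 0 < x i}, ∑ ε : Fin n → ℤˣ,
      F (evenLocations (singularValues fun i => signVal (ε i) * x i)) *
        ENNReal.ofReal ((∏ k, w (signVal (ε k) * x k)) *
          |vandermondeDet fun i => signVal (ε i) * x i|) =
      ∫⁻ x in positiveChamber n, F (evenLocations x) *
        (ENNReal.ofReal (2 ^ n * A fun j => x (locationEquiv n (Sum.inl j))) *
          ENNReal.ofReal (B fun i => x (locationEquiv n (Sum.inr i)))) := by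
    refine setLIntegral_congr_fun (measurableSet_positiveChamber n) fun x hx => ?_
    have hxe : x = mergeLocations (fun j => x (locationEquiv n (Sum.inl j)),
        fun i => x (locationEquiv n (Sum.inr i))) := by
      ext k
      obtain ⟨a | a, rfl⟩ := (locationEquiv n).surjective k <;> simp
    simp only [singularValues_sign_mul hx]
    rw [← Finset.mul_sum, ← ENNReal.ofReal_sum_of_nonneg, h.sum_density_sign_mul hx hxe,
      ENNReal.ofReal_mul]
    · have ht := ((mergeLocations_mem_positiveChamber_iff _ _).mp (hxe ▸ hx)).1
      exact mul_nonneg (by positivity) (hA0 _ ht)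
    · exact fun ε _ => mul_nonneg (Finset.prod_nonneg fun k _ => h.nonneg _) (abs_nonneg _)
  have hGm : Measurable ((positiveChamber n).indicator fun x => F (evenLocations x) *
      (ENNReal.ofReal (2 ^ n * A fun j => x (locationEquiv n (Sum.inl j))) *
        ENNReal.ofReal (B fun i => x (locationEquiv n (Sum.inr i))))) := by
    refine Measurable.indicator ?_ (measurableSet_positiveChamber n)
    refine (hF.comp (measurable_pi_lambda _ fun j => measurable_pi_apply _)).mul ?_
    have h1 : Measurable fun (x : Fin n → ℝ) j => x (locationEquiv n (Sum.inl j)) := by fun_prop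
    have h2 : Measurable fun (x : Fin n → ℝ) j => x (locationEquiv n (Sum.inr j)) := by fun_prop
    exact ((hAm.comp h1).const_mul _).ennreal_ofReal.mul (hBm.comp h2).ennreal_ofReal
  rw [hfold, ← lintegral_indicator (measurableSet_positiveChamber n),
    ← (measurePreserving_mergeLocations n).lintegral_comp hGm]
  -- On the chamber the integrand is a function of `t` times a function of `o`, and the condition on
  -- `o` given `t` is membership in the box of interlacing intervals.
  have hsplit : ∀ p : (Fin (n / 2) → ℝ) × (Fin ((n + 1) / 2) → ℝ),
      (positiveChamber n).indicator (fun x => F (evenLocations x) *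
        (ENNReal.ofReal (2 ^ n * A fun j => x (locationEquiv n (Sum.inl j))) *
          ENNReal.ofReal (B fun i => x (locationEquiv n (Sum.inr i))))) (mergeLocations p) =
      (positiveChamber (n / 2)).indicator (fun t => F t * ENNReal.ofReal (2 ^ n * A t)) p.1 *
        (Set.univ.pi fun i : Fin ((n + 1) / 2) =>
          interlacingInterval (extendByZero p.1) i).indicator
            (fun o => ENNReal.ofReal (B o)) p.2 := by
    rintro ⟨t, o⟩
    have := mergeLocations_mem_positiveChamber_iff t o
    by_cases h1 : t ∈ positiveChamber (n / 2) <;>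
    by_cases h2 : o ∈ Set.univ.pi fun i : Fin ((n + 1) / 2) =>
      interlacingInterval (extendByZero t) i
    · rw [Set.indicator_of_mem (this.mpr ⟨h1, h2⟩), Set.indicator_of_mem h1,
        Set.indicator_of_mem h2, evenLocations_mergeLocations]
      simp only [mergeLocations_inl, mergeLocations_inr, mul_assoc]
    · rw [Set.indicator_of_notMem (fun h => h2 (this.mp h).2), Set.indicator_of_notMem h2, mul_zero]
    · rw [Set.indicator_of_notMem (fun h => h1 (this.mp h).1), Set.indicator_of_notMem h1, zero_mul]
    · rw [Set.indicator_of_notMem (fun h => h1 (this.mp h).1), Set.indicator_of_notMem h1, zero_mul]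
  rw [show (volume : Measure ((Fin (n / 2) → ℝ) × (Fin ((n + 1) / 2) → ℝ))) =
    (volume : Measure (Fin (n / 2) → ℝ)).prod volume from rfl, lintegral_prod]
  rotate_left
  · exact (hGm.comp (measurePreserving_mergeLocations n).measurable).aemeasurable
  simp only [hsplit]
  have hbox : ∀ t : Fin (n / 2) → ℝ, MeasurableSet (Set.univ.pi fun i : Fin ((n + 1) / 2) =>
      interlacingInterval (extendByZero t) i) := fun t =>
    .univ_pi fun i => measurableSet_interlacingInterval _ i
  have hinner : ∀ t : Fin (n / 2) → ℝ, ∫⁻ o,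
      (positiveChamber (n / 2)).indicator (fun t => F t * ENNReal.ofReal (2 ^ n * A t)) t *
        (Set.univ.pi fun i : Fin ((n + 1) / 2) =>
          interlacingInterval (extendByZero t) i).indicator
            (fun o => ENNReal.ofReal (B o)) o =
      (positiveChamber (n / 2)).indicator (fun t => ENNReal.ofReal (2 ^ n * K) * (F t *
          ENNReal.ofReal ((∏ j, t j ^ (2 * (n % 2)) * (w (t j) * W (t j))) *
            vandermondeDet (fun j => t j ^ 2) ^ 2))) t := by
    intro t
    rw [lintegral_const_mul _ (hBm.ennreal_ofReal.indicator (hbox t)),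
      lintegral_indicator (hbox t)]
    by_cases ht : t ∈ positiveChamber (n / 2)
    · have hH := H _ (antitone_extendByZero ht) (extendByZero_nonneg ht)
        (extendByZero_of_le t le_rfl)
      simp only [extendByZero_val] at hH
      rw [Set.indicator_of_mem ht, Set.indicator_of_mem ht, hB, hH, mul_assoc,
        ← ENNReal.ofReal_mul (mul_nonneg (by positivity) (hA0 t ht)), 
        mul_left_comm (ENNReal.ofReal (2 ^ n * K)), ← ENNReal.ofReal_mul (by positivity)]
      congr 2
      rw [hA, ← sq_abs (vandermondeDet _)]
      simp only [Finset.prod_mul_distrib, mul_comm 2 (n % 2), pow_mul, Finset.prod_pow]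
      ring
    · rw [Set.indicator_of_notMem ht, Set.indicator_of_notMem ht, zero_mul]
  simp only [hinner]
  rw [lintegral_indicator (measurableSet_positiveChamber _), lintegral_const_mul, ← mul_assoc,
    ← ENNReal.ofReal_natCast, ← ENNReal.ofReal_mul (by positivity)]
  refine hF.mul (Measurable.ennreal_ofReal ?_)
  have hW := h.companion_measurable
  have := (measurable_vandermondeDet (n / 2)).comp
    (show Measurable fun (t : Fin (n / 2) → ℝ) j => t j ^ 2 by fun_prop)
  exact (by fun_prop : Measurable fun t : Fin (n / 2) → ℝ =>
    ∏ j, t j ^ (2 * (n % 2)) * (w (t j) * W (t j))).mul (this.pow_const 2)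

end IsEvenWeightWithCompanion

/-! ### Normalization and equality of the laws -/

theorem isProbabilityMeasure_normalizedMeasure {n : ℕ} {f : (Fin n → ℝ) → ℝ}
    (h0 : ∫⁻ x, ENNReal.ofReal (f x) ≠ 0) (h1 : ∫⁻ x, ENNReal.ofReal (f x) ≠ ⊤) :
    IsProbabilityMeasure (normalizedMeasure f) :=
  ⟨by simp [normalizedMeasure, ENNReal.inv_mul_cancel h0 h1]⟩

/-- If two densities push forward to proportional measures, then the normalized measures have the
same push-forward. -/
theorem map_normalizedMeasure_eq {n m : ℕ} {X : Type*} [MeasurableSpace X]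
    {f : (Fin n → ℝ) → ℝ} {g : (Fin m → ℝ) → ℝ} (hf : Measurable f) (hg : Measurable g)
    {φ : (Fin n → ℝ) → X} {ψ : (Fin m → ℝ) → X} (hφ : Measurable φ) (hψ : Measurable ψ)
    {C : ENNReal} (hC0 : C ≠ 0) (hC : C ≠ ⊤)
    (H : ∀ F : X → ENNReal, Measurable F → ∫⁻ x, F (φ x) * ENNReal.ofReal (f x) =
      C * ∫⁻ x, F (ψ x) * ENNReal.ofReal (g x)) :
    (normalizedMeasure f).map φ = (normalizedMeasure g).map ψ := by
  have hZ : ∫⁻ x, ENNReal.ofReal (f x) = C * ∫⁻ x, ENNReal.ofReal (g x) := by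
    simpa using H (fun _ => 1) measurable_const
  have hmap : ∀ {k : ℕ} {q : (Fin k → ℝ) → ℝ} {χ : (Fin k → ℝ) → X}, Measurable q →
      Measurable χ → ∀ s, MeasurableSet s →
      (volume.withDensity fun x => ENNReal.ofReal (q x)).map χ s =
        ∫⁻ x, s.indicator 1 (χ x) * ENNReal.ofReal (q x) := by
    intro k q χ _ hχ s hs
    rw [Measure.map_apply hχ hs, withDensity_apply _ (hχ hs), ← lintegral_indicator (hχ hs)]
    refine lintegral_congr fun x => ?_
    by_cases hx : χ x ∈ s <;> simp [hx]
  ext s hs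
  rw [normalizedMeasure, normalizedMeasure, Measure.map_smul, Measure.map_smul,
    Measure.smul_apply, Measure.smul_apply, hmap hf hφ s hs, hmap hg hψ s hs,
    H _ (measurable_one.indicator hs), hZ, smul_eq_mul, smul_eq_mul,
    ENNReal.mul_inv (.inl hC0) (.inl hC), ← mul_assoc, mul_right_comm C⁻¹,
    ENNReal.inv_mul_cancel hC0 hC, one_mul]

namespace IsEvenWeightWithCompanion

variable {n : ℕ} {w W : ℝ → ℝ}

theorem integrable_pow_mul (h : IsEvenWeightWithCompanion n w W) {j : ℕ} (hj : j < n) :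
    Integrable fun s => s ^ j * w s := by
  have h1 := h.integrableOn j hj
  have h2 : IntegrableOn (fun s => s ^ j * w s) (Set.Iio 0) := by
    rw [← (Measure.measurePreserving_neg (volume : Measure ℝ)).integrableOn_comp_preimage
      (Homeomorph.neg ℝ).measurableEmbedding]
    simp only [Set.neg_preimage, Set.neg_Iio, neg_zero]
    refine (h1.const_mul ((-1) ^ j)).congr (.of_forall fun s => ?_)
    simp only [Function.comp_apply, h.even]
    rw [neg_pow s]
    ring
  have h3 : IntegrableOn (fun s => s ^ j * w s) (Set.Ici 0) := by
    rwa [integrableOn_Ici_iff_integrableOn_Ioi]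
  rw [← integrableOn_univ, ← Set.Iio_union_Ici (a := (0 : ℝ))]
  exact h2.union h3

theorem det_pow_mul_eq (x : Fin n → ℝ) :
    (Matrix.of fun i k : Fin n => x i ^ (k : ℕ) * w (x i)).det =
      (∏ k, w (x k)) * vandermondeDet x := by
  rw [vandermondeDet, ← Matrix.det_mul_column]
  congr 1
  ext i k
  simp [Matrix.vandermonde_apply, mul_comm]

/-- The density of the orthogonal ensemble is the absolute value of a determinant of integrable
functions of the single variables, hence integrable. -/
theorem lintegral_density_ne_top (h : IsEvenWeightWithCompanion n w W) :
    ∫⁻ x : Fin n → ℝ, ENNReal.ofReal ((∏ k, w (x k)) * |vandermondeDet x|) ≠ ⊤ := by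
  have hint : Integrable fun x : Fin n → ℝ => (∏ k, w (x k)) * |vandermondeDet x| := by
    have := (integrable_det_pi (ν := fun _ : Fin n => volume)
      (fun k s => s ^ (k : ℕ) * w s) fun _ k => h.integrable_pow_mul k.2).abs
    rw [← volume_pi] at this
    refine this.congr (.of_forall fun x => ?_)
    simp only [det_pow_mul_eq, abs_mul]
    rw [abs_of_nonneg (Finset.prod_nonneg fun k _ => h.nonneg _)]
  exact hint.lintegral_lt_top.ne

theorem measurable_density (h : IsEvenWeightWithCompanion n w W) :
    Measurable fun x : Fin n → ℝ => (∏ k, w (x k)) * |vandermondeDet x| := by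
  have := (measurable_vandermondeDet n).abs
  have := h.measurable
  fun_prop

theorem lintegral_density_ne_zero (h : IsEvenWeightWithCompanion n w W) :
    ∫⁻ x : Fin n → ℝ, ENNReal.ofReal ((∏ k, w (x k)) * |vandermondeDet x|) ≠ 0 := by
  intro h0
  rw [lintegral_eq_zero_iff h.measurable_density.ennreal_ofReal] at h0
  -- All weights are positive on `(0, 1)`, so the density is positive almost everywhere on a cube.
  have hne : ∀ᵐ x : Fin n → ℝ, x ∉ Set.univ.pi fun _ : Fin n => Set.Ioo (0 : ℝ) 1 := by
    filter_upwards [h0, ae_injective n] with x hx hinj hmem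
    have hpos : 0 < (∏ k, w (x k)) * |vandermondeDet x| :=
      mul_pos (Finset.prod_pos fun k _ => h.pos _ (hmem k trivial))
        (abs_pos.mpr (Matrix.det_vandermonde_ne_zero_iff.mpr hinj))
    exact absurd hx (by simpa using hpos)
  have := measure_eq_zero_iff_ae_notMem.mpr hne
  simp [volume_pi_pi] at this

/-- The even-location singular values for any weight with a companion `W`: their law is the chiral
unitary ensemble with a weight that agrees with `x ^ (2 * (n % 2)) * (w x * W x)` on `(0, ∞)`. -/
theorem map_evenLocations_singularValues (h : IsEvenWeightWithCompanion n w W) {w₂ : ℝ → ℝ}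
    (hw₂ : Measurable w₂) (hW : ∀ x > 0, w₂ x = w x * W x) :
    IsProbabilityMeasure (orthogonalEnsemble n w) ∧
    IsProbabilityMeasure (chiralUnitaryEnsemble (n / 2) fun x => x ^ (2 * (n % 2)) * w₂ x) ∧
    evenDecimatedSingularValues n w =
      (chiralUnitaryEnsemble (n / 2) fun x => x ^ (2 * (n % 2)) * w₂ x).map sortDecreasing := by
  obtain ⟨C, hC, H⟩ := h.lintegral_evenLocations
  set v : ℝ → ℝ := (Set.Ioi (0 : ℝ)).indicator fun x => x ^ (2 * (n % 2)) * w₂ x with hv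
  have hvm : Measurable v := (by fun_prop : Measurable fun x : ℝ =>
    x ^ (2 * (n % 2)) * w₂ x).indicator measurableSet_Ioi
  set g : (Fin (n / 2) → ℝ) → ℝ := fun t =>
    (∏ j, v (t j)) * vandermondeDet (fun j => t j ^ 2) ^ 2 with hg
  have hgm : Measurable g := by
    have := (measurable_vandermondeDet (n / 2)).comp
      (show Measurable fun (t : Fin (n / 2) → ℝ) j => t j ^ 2 by fun_prop)
    exact (by fun_prop : Measurable fun t : Fin (n / 2) → ℝ => ∏ j, v (t j)).mul
      (this.pow_const 2)
  -- The chiral ensemble folded onto the same chamber; only permutations are needed, because its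
  -- density vanishes unless all coordinates are positive.
  have hchUE : ∀ F : (Fin (n / 2) → ℝ) → ENNReal, Measurable F →
      ∫⁻ t, F (sortDecreasing t) * ENNReal.ofReal (g t) =
        (n / 2).factorial * ∫⁻ t in positiveChamber (n / 2), F t *
          ENNReal.ofReal ((∏ j, t j ^ (2 * (n % 2)) * (w (t j) * W (t j))) *
            vandermondeDet (fun j => t j ^ 2) ^ 2) := by
    intro F hF
    rw [lintegral_symmetric]
    · congr 1
      rw [← lintegral_indicator (measurableSet_strictAnti _),
        ← lintegral_indicator (measurableSet_positiveChamber _)]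
      refine lintegral_congr fun t => ?_
      by_cases ht : StrictAnti t
      · rw [Set.indicator_of_mem ht, sortDecreasing_of_strictAnti ht]
        by_cases hp : ∀ i, 0 < t i
        · rw [Set.indicator_of_mem (show t ∈ positiveChamber _ from ⟨ht, hp⟩), hg]
          congr 2
          refine congr_arg (· * _) (Finset.prod_congr rfl fun j _ => ?_)
          rw [hv, Set.indicator_of_mem (Set.mem_Ioi.mpr (hp j)), hW _ (hp j)]
        · rw [Set.indicator_of_notMem fun h => hp h.2]
          obtain ⟨i, hi⟩ := not_forall.mp hp
          have : g t = 0 := by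
            rw [hg]
            dsimp only
            rw [Finset.prod_eq_zero (Finset.mem_univ i) (Set.indicator_of_notMem hi _), zero_mul]
          rw [this, ENNReal.ofReal_zero, mul_zero]
      · rw [Set.indicator_of_notMem ht, Set.indicator_of_notMem fun h => ht h.1]
    · exact (hF.comp (measurable_sortDecreasing _)).mul hgm.ennreal_ofReal
    · intro π t
      have h1 : ∏ j, v ((t ∘ π) j) = ∏ j, v (t j) := Equiv.prod_comp π fun j => v (t j)
      have h2 := abs_vandermondeDet_comp_perm (fun j => t j ^ 2) π
      have h3 : g (t ∘ π) = g t := by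
        rw [hg]
        dsimp only
        rw [h1, ← sq_abs, ← sq_abs (vandermondeDet fun j => t j ^ 2), ← h2]
        rfl
      rw [sortDecreasing_comp_perm, h3]
  have hfac : (0 : ℝ) < (n / 2).factorial := by positivity
  have hD : 0 < C / (n / 2).factorial := div_pos hC hfac
  have hprop : ∀ F : (Fin (n / 2) → ℝ) → ENNReal, Measurable F →
      ∫⁻ x : Fin n → ℝ, F (evenLocations (singularValues x)) *
          ENNReal.ofReal ((∏ k, w (x k)) * |vandermondeDet x|) =
        ENNReal.ofReal (C / (n / 2).factorial) *
          ∫⁻ t, F (sortDecreasing t) * ENNReal.ofReal (g t) := by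
    intro F hF
    rw [H F hF, hchUE F hF, ← mul_assoc, ← ENNReal.ofReal_natCast, ← ENNReal.ofReal_mul hD.le,
      div_mul_cancel₀ _ hfac.ne']
  have hZ : ∫⁻ x : Fin n → ℝ, ENNReal.ofReal ((∏ k, w (x k)) * |vandermondeDet x|) =
      ENNReal.ofReal (C / (n / 2).factorial) * ∫⁻ t, ENNReal.ofReal (g t) := by
    simpa using hprop (fun _ => 1) measurable_const
  have hD0 : ENNReal.ofReal (C / (n / 2).factorial) ≠ 0 := (ENNReal.ofReal_pos.mpr hD).ne'
  refine ⟨isProbabilityMeasure_normalizedMeasure h.lintegral_density_ne_zero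
    h.lintegral_density_ne_top, isProbabilityMeasure_normalizedMeasure ?_ ?_, ?_⟩
  · exact fun h0 => h.lintegral_density_ne_zero (hZ.trans (by rw [h0, mul_zero]))
  · exact fun h1 => h.lintegral_density_ne_top (hZ.trans (by rw [h1, ENNReal.mul_top hD0]))
  · exact map_normalizedMeasure_eq h.measurable_density hgm
      (measurable_evenLocations_singularValues n) (measurable_sortDecreasing _) hD0
      ENNReal.ofReal_ne_top hprop

end IsEvenWeightWithCompanion

/-! ### The classical weights -/

/-- The integrand in `IsEvenWeightWithCompanion.integral_Ioi` is a combination of the moment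
integrands of orders `j ± 1 < n`. -/
theorem integrableOn_sub_mul {w : ℝ → ℝ} {n j : ℕ} (hj : j + 2 ≤ n)
    (hw : ∀ j < n, IntegrableOn (fun s => s ^ j * w s) (Set.Ioi 0)) (c : ℝ) {u : ℝ} (hu : 0 ≤ u) :
    IntegrableOn (fun s => (s ^ (j + 1) - j * c * s ^ (j - 1)) * w s) (Set.Ioi u) := by
  refine IntegrableOn.mono_set ?_ (Set.Ioi_subset_Ioi hu)
  refine ((hw (j + 1) (by omega)).sub ((hw (j - 1) (by omega)).const_mul (j * c))).congr
    (.of_forall fun s => ?_)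
  simp only [Pi.sub_apply]
  ring

theorem integrableOn_pow_mul_gauss (j : ℕ) :
    IntegrableOn (fun s : ℝ => s ^ j * Real.exp (-s ^ 2 / 2)) (Set.Ioi 0) := by
  have h := integrable_rpow_mul_exp_neg_mul_sq (b := 1 / 2) (by norm_num)
    (s := j) (by linarith [(Nat.cast_nonneg j : (0 : ℝ) ≤ j)])
  refine h.integrableOn.congr (.of_forall fun s => ?_)
  simp only [Real.rpow_natCast]
  congr 2
  ring

/-- The Gauss weight is its own companion, with all constants `c = 1`. -/
theorem isEvenWeightWithCompanion_gauss (n : ℕ) :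
    IsEvenWeightWithCompanion n (fun x => Real.exp (-x ^ 2 / 2))
      (fun x => Real.exp (-x ^ 2 / 2)) where
  measurable := by fun_prop
  nonneg x := (Real.exp_pos _).le
  even x := by simp
  pos x _ := Real.exp_pos _
  integrableOn j _ := integrableOn_pow_mul_gauss j
  companion_measurable := by fun_prop
  companion_nonneg x := (Real.exp_pos _).le
  integral_Ioi j hj := by
    refine ⟨1, one_pos, fun u hu => ?_⟩
    have hderiv : ∀ s ∈ Set.Ici u, HasDerivAt (fun s : ℝ => -(s ^ j * Real.exp (-s ^ 2 / 2)))
        ((s ^ (j + 1) - j * 1 * s ^ (j - 1)) * Real.exp (-s ^ 2 / 2)) s := by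
      intro s _
      have h1 : HasDerivAt (fun s : ℝ => -s ^ 2 / 2) (-s) s := by
        have := ((hasDerivAt_pow 2 s).neg).div_const 2
        refine this.congr_deriv ?_
        simp only [Nat.cast_ofNat]
        ring
      refine (((hasDerivAt_pow j s).mul h1.exp).neg).congr_deriv ?_
      ring
    have hlim : Filter.Tendsto (fun s : ℝ => -(s ^ j * Real.exp (-s ^ 2 / 2))) Filter.atTop
        (nhds 0) := by
      have := ((rpow_mul_exp_neg_mul_sq_isLittleO_exp_neg (b := 1 / 2) (by norm_num)
        j).trans_tendsto (by
          refine Real.tendsto_exp_neg_atTop_nhds_zero.comp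
            (Filter.tendsto_id.const_mul_atTop (show (0 : ℝ) < 1 / 2 by norm_num)) |>.congr ?_
          intro x
          simp)).neg
      rw [neg_zero] at this
      refine this.congr fun s => ?_
      simp only [Real.rpow_natCast]
      congr 3
      ring
    rw [integral_Ioi_of_hasDerivAt_of_tendsto' hderiv
      (integrableOn_sub_mul hj (fun j _ => integrableOn_pow_mul_gauss j) 1 hu) hlim]
    ring

theorem abs_pow_le_one_add_sq_rpow (s : ℝ) (j : ℕ) : |s| ^ j ≤ (1 + s ^ 2) ^ ((j : ℝ) / 2) := by
  rw [div_eq_mul_inv, mul_comm, Real.rpow_mul (by positivity), Real.rpow_natCast]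
  refine pow_le_pow_left₀ (abs_nonneg s) ?_ j
  rw [← one_div, ← Real.sqrt_eq_rpow]
  exact Real.abs_le_sqrt (by linarith)

theorem integrableOn_pow_mul_cauchy {n j : ℕ} (hj : j < n) {a : ℝ} (ha : -1 < a) :
    IntegrableOn (fun s : ℝ => s ^ j * (1 + s ^ 2) ^ (-((n : ℝ) + a + 1) / 2)) (Set.Ioi 0) := by
  have h := integrable_rpow_neg_one_add_norm_sq (E := ℝ) (μ := volume) (r := a + 2)
    (by simp; linarith)
  refine Integrable.integrableOn (h.mono' (by fun_prop) (.of_forall fun s => ?_))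
  have hpos : 0 < 1 + s ^ 2 := by positivity
  rw [norm_mul, norm_pow, Real.norm_eq_abs, Real.norm_of_nonneg (Real.rpow_nonneg hpos.le _),
    sq_abs]
  calc |s| ^ j * (1 + s ^ 2) ^ (-((n : ℝ) + a + 1) / 2)
      ≤ (1 + s ^ 2) ^ ((j : ℝ) / 2) * (1 + s ^ 2) ^ (-((n : ℝ) + a + 1) / 2) := by
        gcongr
        exact abs_pow_le_one_add_sq_rpow s j
    _ = (1 + s ^ 2) ^ ((j : ℝ) / 2 + -((n : ℝ) + a + 1) / 2) := (Real.rpow_add hpos _ _).symm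
    _ ≤ (1 + s ^ 2) ^ (-(a + 2) / 2) := by
        refine Real.rpow_le_rpow_of_exponent_le (by nlinarith) ?_
        have : (j : ℝ) + 1 ≤ n := by exact_mod_cast hj
        linarith

/-- The companion of the Cauchy weight is `(1 + x²) w(x)`. The restriction `j ≤ n - 2` makes
`W(u) u ^ j` decay and the constants `c⁻¹ = n + a - 1 - j` positive. -/
theorem isEvenWeightWithCompanion_cauchy (n : ℕ) {a : ℝ} (ha : -1 < a) :
    IsEvenWeightWithCompanion n (fun x => (1 + x ^ 2) ^ (-((n : ℝ) + a + 1) / 2))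
      (fun x => (1 + x ^ 2) ^ (-((n : ℝ) + a - 1) / 2)) where
  measurable := by fun_prop
  nonneg x := by positivity
  even x := by simp
  pos x _ := by positivity
  integrableOn j hj := integrableOn_pow_mul_cauchy hj ha
  companion_measurable := by fun_prop
  companion_nonneg x := by positivity
  integral_Ioi j hj := by
    have hjn : (j : ℝ) + 2 ≤ n := by exact_mod_cast hj
    have hd : 0 < (n : ℝ) + a - 1 - j := by linarith
    refine ⟨((n : ℝ) + a - 1 - j)⁻¹, inv_pos.mpr hd, fun u hu => ?_⟩
    set c := ((n : ℝ) + a - 1 - j)⁻¹ with hc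
    have hcd : c * ((n : ℝ) + a - 1 - j) = 1 := inv_mul_cancel₀ hd.ne'
    have hderiv : ∀ s ∈ Set.Ici u,
        HasDerivAt (fun s : ℝ => -(c * ((1 + s ^ 2) ^ (-((n : ℝ) + a - 1) / 2) * s ^ j)))
        ((s ^ (j + 1) - j * c * s ^ (j - 1)) * (1 + s ^ 2) ^ (-((n : ℝ) + a + 1) / 2)) s := by
      intro s _
      have hpos : 0 < 1 + s ^ 2 := by positivity
      have h1 : HasDerivAt (fun s : ℝ => 1 + s ^ 2) (2 * s) s := by
        simpa using (hasDerivAt_pow 2 s).const_add 1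
      have h2 := h1.rpow_const (p := -((n : ℝ) + a - 1) / 2) (.inl hpos.ne')
      have e1 : -((n : ℝ) + a - 1) / 2 - 1 = -((n : ℝ) + a + 1) / 2 := by ring
      have e2 : (1 + s ^ 2) ^ (-((n : ℝ) + a - 1) / 2) =
          (1 + s ^ 2) ^ (-((n : ℝ) + a + 1) / 2) * (1 + s ^ 2) := by
        rw [← Real.rpow_add_one hpos.ne']
        congr 1
        ring
      refine (((h2.mul (hasDerivAt_pow j s)).const_mul c).neg).congr_deriv ?_
      rw [e1, e2]
      rcases j with _ | j
      · simp only [Nat.cast_zero, sub_zero] at hcd ⊢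
        linear_combination (s * (1 + s ^ 2) ^ (-((n : ℝ) + a + 1) / 2)) * hcd
      · simp only [Nat.add_sub_cancel]
        linear_combination (s ^ (j + 2) * (1 + s ^ 2) ^ (-((n : ℝ) + a + 1) / 2)) * hcd
    have hlim : Filter.Tendsto
        (fun s : ℝ => -(c * ((1 + s ^ 2) ^ (-((n : ℝ) + a - 1) / 2) * s ^ j))) Filter.atTop
        (nhds 0) := by
      have h1 : Filter.Tendsto (fun s : ℝ => 1 + s ^ 2) Filter.atTop Filter.atTop :=
        Filter.tendsto_atTop_add_const_left _ _ (Filter.tendsto_pow_atTop two_ne_zero)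
      have h2 := (tendsto_rpow_neg_atTop (half_pos hd)).comp h1
      have h3 : Filter.Tendsto (fun s : ℝ => (1 + s ^ 2) ^ (-((n : ℝ) + a - 1) / 2) * s ^ j)
          Filter.atTop (nhds 0) := by
        refine squeeze_zero_norm (fun s => ?_) h2
        have hpos : 0 < 1 + s ^ 2 := by positivity
        rw [norm_mul, norm_pow, Real.norm_eq_abs s,
          Real.norm_of_nonneg (Real.rpow_nonneg hpos.le _)]
        calc (1 + s ^ 2) ^ (-((n : ℝ) + a - 1) / 2) * |s| ^ j
            ≤ (1 + s ^ 2) ^ (-((n : ℝ) + a - 1) / 2) * (1 + s ^ 2) ^ ((j : ℝ) / 2) := by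
              gcongr
              exact abs_pow_le_one_add_sq_rpow s j
          _ = (1 + s ^ 2) ^ (-(((n : ℝ) + a - 1 - j) / 2)) := by
              rw [← Real.rpow_add hpos]
              congr 1
              ring
      simpa using (h3.const_mul c).neg
    rw [integral_Ioi_of_hasDerivAt_of_tendsto' hderiv
      (integrableOn_sub_mul hj (fun j hj => integrableOn_pow_mul_cauchy hj ha) c hu) hlim]
    ring

theorem one_sub_sq_pos {x : ℝ} (hx : x ∈ Set.Ioo (-1 : ℝ) 1) : 0 < 1 - x ^ 2 := by
  nlinarith [hx.1, hx.2]

/-- The only singularity in `(0, 1)` is the factor `(1 - x) ^ a`, with `a > -1`. -/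
theorem integrableOn_jacobi {a : ℝ} (ha : -1 < a) :
    IntegrableOn ((Set.Ioo (-1 : ℝ) 1).indicator fun x => (1 - x ^ 2) ^ a) (Set.Ioi 0) := by
  have h1 : IntervalIntegrable (fun x : ℝ => (1 - x) ^ a) volume 0 1 := by
    simpa using ((intervalIntegral.intervalIntegrable_rpow' (a := 0) (b := 1) ha).comp_sub_left
      1).symm
  have h2 : IntervalIntegrable (fun x : ℝ => (1 - x) ^ a * (1 + x) ^ a) volume 0 1 := by
    refine h1.mul_continuousOn (ContinuousOn.rpow_const (by fun_prop) fun x hx => .inl ?_)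
    rw [Set.uIcc_of_le zero_le_one] at hx
    linarith [hx.1]
  rw [intervalIntegrable_iff_integrableOn_Ioo_of_le zero_le_one] at h2
  have h3 : IntegrableOn ((Set.Ioo (-1 : ℝ) 1).indicator fun x => (1 - x ^ 2) ^ a)
      (Set.Ioo 0 1) := by
    refine h2.congr_fun (fun x hx => ?_) measurableSet_Ioo
    have hx' : x ∈ Set.Ioo (-1 : ℝ) 1 := ⟨by linarith [hx.1], hx.2⟩
    have e1 : 0 ≤ 1 - x := by linarith [hx.2]
    have e2 : 0 ≤ 1 + x := by linarith [hx.1]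
    rw [Set.indicator_of_mem hx']
    dsimp only
    rw [← Real.mul_rpow e1 e2]
    congr 1
    ring
  refine h3.of_forall_sdiff_eq_zero measurableSet_Ioi fun x hx => ?_
  exact Set.indicator_of_notMem (fun h => hx.2 ⟨hx.1, h.2⟩) _

theorem integrableOn_pow_mul_jacobi (j : ℕ) {a : ℝ} (ha : -1 < a) :
    IntegrableOn (fun s : ℝ => s ^ j * (Set.Ioo (-1 : ℝ) 1).indicator (fun x => (1 - x ^ 2) ^ a) s)
      (Set.Ioi 0) := by
  refine Integrable.mono (integrableOn_jacobi ha) ?_ (.of_forall fun s => ?_)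
  · refine AEStronglyMeasurable.mul (by fun_prop) (integrableOn_jacobi ha).aestronglyMeasurable
  · by_cases hs : s ∈ Set.Ioo (-1 : ℝ) 1
    · rw [norm_mul, norm_pow]
      exact mul_le_of_le_one_left (norm_nonneg _)
        (pow_le_one₀ (norm_nonneg _) (abs_le.mpr ⟨hs.1.le, hs.2.le⟩))
    · simp [Set.indicator_of_notMem hs]

/-- The companion of the Jacobi weight is `(1 - x²) w(x)`, with constants `c⁻¹ = 2a + 2 + j`. -/
theorem isEvenWeightWithCompanion_jacobi (n : ℕ) {a : ℝ} (ha : -1 < a) :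
    IsEvenWeightWithCompanion n ((Set.Ioo (-1 : ℝ) 1).indicator fun x => (1 - x ^ 2) ^ a)
      ((Set.Ioo (-1 : ℝ) 1).indicator fun x => (1 - x ^ 2) ^ (a + 1)) where
  measurable := (by fun_prop : Measurable fun x : ℝ => (1 - x ^ 2) ^ a).indicator measurableSet_Ioo
  nonneg := Set.indicator_nonneg fun x hx => Real.rpow_nonneg (one_sub_sq_pos hx).le _
  even x := by
    have : -x ∈ Set.Ioo (-1 : ℝ) 1 ↔ x ∈ Set.Ioo (-1 : ℝ) 1 := by
      simp only [Set.mem_Ioo]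
      constructor <;> rintro ⟨h1, h2⟩ <;> constructor <;> linarith
    simp [Set.indicator_apply, this]
  pos x hx := by
    have hx' : x ∈ Set.Ioo (-1 : ℝ) 1 := ⟨by linarith [hx.1], hx.2⟩
    rw [Set.indicator_of_mem hx']
    exact Real.rpow_pos_of_pos (one_sub_sq_pos hx') _
  integrableOn j _ := integrableOn_pow_mul_jacobi j ha
  companion_measurable :=
    (by fun_prop : Measurable fun x : ℝ => (1 - x ^ 2) ^ (a + 1)).indicator measurableSet_Ioo
  companion_nonneg := Set.indicator_nonneg fun x hx => Real.rpow_nonneg (one_sub_sq_pos hx).le _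
  integral_Ioi j hj := by
    have hd : 0 < 2 * a + 2 + j := by linarith [(Nat.cast_nonneg j : (0 : ℝ) ≤ j)]
    refine ⟨(2 * a + 2 + j)⁻¹, inv_pos.mpr hd, fun u hu => ?_⟩
    set c := (2 * a + 2 + j)⁻¹ with hc
    have hcd : c * (2 * a + 2 + j) = 1 := inv_mul_cancel₀ hd.ne'
    rcases le_or_gt 1 u with hu1 | hu1
    · rw [Set.indicator_of_notMem (fun h => hu1.not_gt h.2), mul_zero, zero_mul]
      refine setIntegral_eq_zero_of_forall_eq_zero fun s hs => ?_
      rw [Set.indicator_of_notMem (fun h => (hu1.trans (le_of_lt hs)).not_gt h.2), mul_zero]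
    · have hint := integrableOn_sub_mul hj (fun j _ => integrableOn_pow_mul_jacobi j ha) c hu
      have hmem : ∀ s ∈ Set.Ioo u 1, s ∈ Set.Ioo (-1 : ℝ) 1 := fun s hs =>
        ⟨by linarith [hs.1], hs.2⟩
      have hset : ∫ s in Set.Ioi u, (s ^ (j + 1) - j * c * s ^ (j - 1)) *
            (Set.Ioo (-1 : ℝ) 1).indicator (fun x => (1 - x ^ 2) ^ a) s =
          ∫ s in Set.Ioo u 1, (s ^ (j + 1) - j * c * s ^ (j - 1)) * (1 - s ^ 2) ^ a := by
        refine (setIntegral_eq_of_subset_of_forall_sdiff_eq_zero measurableSet_Ioi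
          (Set.Ioo_subset_Ioi_self (a := 1)) fun s hs => ?_).trans
            (setIntegral_congr_fun measurableSet_Ioo fun s hs => ?_)
        · rw [Set.indicator_of_notMem (fun h => hs.2 ⟨hs.1, h.2⟩), mul_zero]
        · rw [Set.indicator_of_mem (hmem s hs)]
      have hint' : IntervalIntegrable
          (fun s => (s ^ (j + 1) - j * c * s ^ (j - 1)) * (1 - s ^ 2) ^ a) volume u 1 := by
        rw [intervalIntegrable_iff_integrableOn_Ioo_of_le hu1.le]
        refine (hint.mono_set (Set.Ioo_subset_Ioi_self (a := 1))).congr_fun (fun s hs => ?_)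
          measurableSet_Ioo
        dsimp only
        rw [Set.indicator_of_mem (hmem s hs)]
      have hcont : ContinuousOn (fun s : ℝ => -(c * ((1 - s ^ 2) ^ (a + 1) * s ^ j)))
          (Set.Icc u 1) := by
        have : ContinuousOn (fun s : ℝ => (1 - s ^ 2) ^ (a + 1)) (Set.Icc u 1) :=
          ContinuousOn.rpow_const (by fun_prop) fun x hx => .inr (by linarith)
        fun_prop
      have hderiv : ∀ s ∈ Set.Ioo u 1,
          HasDerivAt (fun s : ℝ => -(c * ((1 - s ^ 2) ^ (a + 1) * s ^ j)))
            ((s ^ (j + 1) - j * c * s ^ (j - 1)) * (1 - s ^ 2) ^ a) s := by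
        intro s hs
        have hpos : 0 < 1 - s ^ 2 := one_sub_sq_pos (hmem s hs)
        have h1 : HasDerivAt (fun s : ℝ => 1 - s ^ 2) (-(2 * s)) s := by
          simpa using (hasDerivAt_pow 2 s).const_sub 1
        have h2 := h1.rpow_const (p := a + 1) (.inl hpos.ne')
        refine (((h2.mul (hasDerivAt_pow j s)).const_mul c).neg).congr_deriv ?_
        rw [add_sub_cancel_right, Real.rpow_add_one hpos.ne']
        rcases j with _ | j
        · simp only [Nat.cast_zero, add_zero] at hcd ⊢
          linear_combination (s * (1 - s ^ 2) ^ a) * hcd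
        · simp only [Nat.add_sub_cancel]
          linear_combination (s ^ (j + 2) * (1 - s ^ 2) ^ a) * hcd
      rw [hset, ← integral_Ioc_eq_integral_Ioo, ← intervalIntegral.integral_of_le hu1.le,
        intervalIntegral.integral_eq_sub_of_hasDerivAt_of_le hu1.le hcont hderiv hint',
        Set.indicator_of_mem (show u ∈ Set.Ioo (-1 : ℝ) 1 from ⟨by linarith, hu1⟩)]
      have : (1 - (1 : ℝ) ^ 2) ^ (a + 1) = 0 := by
        rw [one_pow, sub_self, Real.zero_rpow (by linarith)]
      rw [this]
      ring

theorem theorem1 (n : ℕ) (w₁ w₂ : ℝ → ℝ) (hw : IsEvenWeightPair n w₁ w₂) :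
    IsProbabilityMeasure (orthogonalEnsemble n w₁) ∧
    IsProbabilityMeasure (chiralUnitaryEnsemble (n / 2) fun x => x ^ (2 * (n % 2)) * w₂ x) ∧
    evenDecimatedSingularValues n w₁ =
      (chiralUnitaryEnsemble (n / 2) fun x => x ^ (2 * (n % 2)) * w₂ x).map sortDecreasing := by
  cases hw with
  | gauss =>
    refine (isEvenWeightWithCompanion_gauss n).map_evenLocations_singularValues (by fun_prop)
      fun x _ => ?_
    rw [← Real.exp_add]
    congr 1
    ring
  | jacobi a ha =>
    refine (isEvenWeightWithCompanion_jacobi n ha).map_evenLocations_singularValues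
      ((by fun_prop : Measurable fun x : ℝ => (1 - x ^ 2) ^ (2 * a + 1)).indicator
        measurableSet_Ioo) fun x _ => ?_
    by_cases hx : x ∈ Set.Ioo (-1 : ℝ) 1
    · rw [Set.indicator_of_mem hx, Set.indicator_of_mem hx, Set.indicator_of_mem hx,
        ← Real.rpow_add (one_sub_sq_pos hx)]
      congr 1
      ring
    · simp [Set.indicator_of_notMem hx]
  | cauchy a ha =>
    refine (isEvenWeightWithCompanion_cauchy n ha).map_evenLocations_singularValues (by fun_prop)
      fun x _ => ?_
    rw [← Real.rpow_add (by positivity)]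
    congr 1
    ring
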